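/- Let $\mathbb F_q$ be a finite field with $q$ elements ($q$ prime, for instance), $\mathsf X$ a finite set, and $P_{XV_1V_2}$ a probability mass function on $\mathsf X\times\mathbb F_q\times\mathbb F_q$. A word $z\in\mathsf Z^n$ is $\epsilon$-typical for a pmf $p$ on a finite set $\mathsf Z$ if $|N(a|z)-n\,p(a)|\le \epsilon\, n\,p(a)$ for all $a\in\mathsf Z$, where $N(a|z)$ is the number of occurrences of $a$ in $z$; $A^n_\epsilon(p)$ is the set of these words. Let $m\in\mathbb N$, and let $U_{1,i},U_{2,i}$ ($1\le i\le m$) be random variables on $\mathbb F_q$, with $U_{1,i}$ independent of $U_{2,i}$. A pair of nested quasi-linear codes (NQLC's) of length $n$ with dimensions $k_1,\dots,k_m$, parameter $\epsilon$ and these random variables is a pair $$\mathcal C_j=\Big\{\sum_{i=1}^m \mathbf u_iG_i+\mathbf b_j \;\Big|\; \mathbf u_i\in A_\epsilon^{k_i}(U_{j,i}),\ 1\le i\le m\Big\}\subseteq\mathbb F_q^n,\qquad j=1,2,$$ with common matrices $G_i\in\mathbb F_q^{k_i\times n}$ and dithers $\mathbf b_1,\mathbf b_2\in\mathbb F_q^n$.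 A sequence of code pairs $(\mathcal C_1^n,\mathcal C_2^n)_n$, with $\mathcal C_j^n\subseteq\mathbb F_q^n$, is $P_{XV_1V_2}$-covering if for every $\epsilon>0$, with $X^n$ i.i.d. of law $P_X$, $$\Pr\big\{\exists (v_1^n,v_2^n)\in\mathcal C_1^n\times\mathcal C_2^n:\ (X^n,v_1^n,v_2^n)\in A^n_\epsilon(P_{XV_1V_2})\big\}\to1\quad(n\to\infty).$$ Let $\rho_1,\dots,\rho_m>0$ (the limits of the ratios $k_i/n$), and consider the bounds $$\sum_{i}\rho_iH(U_{1,i})\ge\log q-H(V_1|X),\qquad \sum_{i}\rho_iH(U_{2,i})\ge\log q-H(V_2|X),$$ $$\sum_{i}\rho_i\big(H(U_{1,i})+H(U_{2,i})\big)\ge2\log q-H(V_1,V_2|X),$$ $$\sum_{i}\rho_iH(\alpha U_{1,i}+\beta U_{2,i})\ge\log q-H(\alpha V_1+\beta V_2|X)\qquad\text{for all }\alpha,\beta\in\mathbb F_q\setminus\{0\}.$$ (a) If these bounds hold, then there are dimensions $k_i^{(n)}\in\mathbb N$ with $k_i^{(n)}/n\to\rho_i$ for all $i$, parameters $\epsilon_n>0$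 with $\epsilon_n\to0$, and, for every $n$, a pair of NQLC's $(\mathcal C_1^n,\mathcal C_2^n)$ of length $n$ with dimensions $k_i^{(n)}$, parameter $\epsilon_n$ and random variables $(U_{1,i})_i,(U_{2,i})_i$, such that the sequence $(\mathcal C_1^n,\mathcal C_2^n)_n$ is $P_{XV_1V_2}$-covering. (b) If all of these bounds hold with strict inequality, then for every choice of dimensions $k_i^{(n)}\in\mathbb N$ with $k_i^{(n)}/n\to\rho_i$ for all $i$ there are such $\epsilon_n>0$, $\epsilon_n\to 0$, and pairs of NQLC's with exactly these dimensions. -/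

import Mathlib

open Filter Topology Matrix

namespace NQLC

noncomputable section

/-! Probability mass functions on a finite set `α` are the elements of `stdSimplex ℝ α`. -/

open Classical in
/-- The law of `f Z` when `Z` has mass function `p`. -/
def law {α β : Type*} [Fintype α] (p : α → ℝ) (f : α → β) : β → ℝ :=
  fun b => ∑ a with f a = b, p a

/-- Shannon entropy `-∑ p(a) log p(a)` (natural logarithm). -/
def entropy {α : Type*} [Fintype α] (p : α → ℝ) : ℝ :=
  ∑ a, Real.negMulLog (p a)

/-- Conditional entropy `H(Y | X) = ∑ₓ P(x) H(Y | X = x)` for a mass function `p` of `(X, Y)`.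
An `x` of probability zero contributes `0`. -/
def condEntropy {α β : Type*} [Fintype α] [Fintype β] (p : α × β → ℝ) : ℝ :=
  ∑ x, law p Prod.fst x * entropy (fun y => p (x, y) / law p Prod.fst x)

/-- The law of `s A + t B`, where `A` and `B` are independent with laws `μ` and `ν`. -/
def combLaw {F : Type*} [Field F] [Fintype F] (s t : F) (μ ν : F → ℝ) : F → ℝ :=
  law (fun ab : F × F => μ ab.1 * ν ab.2) (fun ab => s * ab.1 + t * ab.2)

open Classical in
/-- `N(a | x)`, the number of occurrences of the letter `a` in the word `x`. -/
def occ {α : Type*} {n : ℕ} (x : Fin n → α) (a : α) : ℕ :=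
  (Finset.univ.filter fun i => x i = a).card

/-- `x` is `ε`-(frequency-)typical for `p`: `|N(a | x) / n - p(a)| ≤ ε p(a)` for every letter `a`
(multiplied by `n`, so that the empty word is typical). In particular letters of probability zero
do not occur in a typical word. -/
def IsTypical {α : Type*} {n : ℕ} (ε : ℝ) (p : α → ℝ) (x : Fin n → α) : Prop :=
  ∀ a, |(occ x a : ℝ) - n * p a| ≤ ε * (n * p a)

/-- The quasi-linear code
`{∑ᵢ uᵢ Gᵢ + b | uᵢ ∈ A_ε^{kᵢ}(Uᵢ), i = 1, …, m}` of length `n`, where `U i` is the law of `Uᵢ`. -/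
def qlc {F : Type*} [Field F] {m n : ℕ} (k : Fin m → ℕ) (ε : ℝ) (U : Fin m → F → ℝ)
    (G : (i : Fin m) → Matrix (Fin (k i)) (Fin n) F) (b : Fin n → F) : Set (Fin n → F) :=
  {c | ∃ u : (i : Fin m) → Fin (k i) → F,
    (∀ i, IsTypical ε (U i) (u i)) ∧ c = (∑ i, u i ᵥ* G i) + b}

/-- `C₁`, `C₂` is a pair of nested quasi-linear codes: they use the same generator matrices, each
with its own dither and its own family of index laws. -/
def IsNQLCPair {F : Type*} [Field F] {m n : ℕ} (k : Fin m → ℕ) (ε : ℝ)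
    (U₁ U₂ : Fin m → F → ℝ) (C₁ C₂ : Set (Fin n → F)) : Prop :=
  ∃ (G : (i : Fin m) → Matrix (Fin (k i)) (Fin n) F) (b₁ b₂ : Fin n → F),
    C₁ = qlc k ε U₁ G b₁ ∧ C₂ = qlc k ε U₂ G b₂

open Classical in
/-- The probability, for `x₁, …, xₙ` i.i.d. with the `X`-marginal of `P`, that some pair
`(v₁, v₂) ∈ C₁ × C₂` is jointly `ε`-typical with `x` for `P`. -/
def coverProb {𝒳 F : Type*} [Fintype 𝒳] [Fintype F] {n : ℕ} (P : 𝒳 × F × F → ℝ) (ε : ℝ)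
    (C₁ C₂ : Set (Fin n → F)) : ℝ :=
  ∑ x : Fin n → 𝒳 with
      ∃ v₁ ∈ C₁, ∃ v₂ ∈ C₂, IsTypical ε P (fun j => (x j, v₁ j, v₂ j)),
    ∏ j, law P Prod.fst (x j)

/-- The sequence of code pairs `(C₁ n, C₂ n)` is `P_{X V₁ V₂}`-covering. -/
def IsCovering {𝒳 F : Type*} [Fintype 𝒳] [Fintype F] (P : 𝒳 × F × F → ℝ)
    (C₁ C₂ : (n : ℕ) → Set (Fin n → F)) : Prop :=
  ∀ ε : ℝ, 0 < ε → Tendsto (fun n => coverProb P ε (C₁ n) (C₂ n)) atTop (𝓝 1)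

/-- There is a sequence of pairs of nested quasi-linear codes, the pair of length `n` having
dimensions `k n 1, …, k n m` and index laws `U₁`, `U₂`, with typicality parameters tending to `0`,
that is `P_{X V₁ V₂}`-covering. -/
def ExistsCoveringNQLC {𝒳 F : Type*} [Fintype 𝒳] [Field F] [Fintype F] {m : ℕ}
    (P : 𝒳 × F × F → ℝ) (U₁ U₂ : Fin m → F → ℝ) (k : ℕ → Fin m → ℕ) : Prop :=
  ∃ (ε : ℕ → ℝ) (C₁ C₂ : (n : ℕ) → Set (Fin n → F)),
    (∀ n, 0 < ε n) ∧ Tendsto ε atTop (𝓝 0) ∧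
    (∀ n, IsNQLCPair (k n) (ε n) U₁ U₂ (C₁ n) (C₂ n)) ∧
    IsCovering P C₁ C₂

end

end NQLC

open NQLC

/-!
The proof is a second moment argument over a random pair of codes. The generator matrices are
replaced by a uniformly random linear map `L` from tuples of index words to `F ^ n`, which is the
same thing (`exists_generator_matrices`), and the dithers are uniform. For a fixed source word `x`
one counts the index pairs `(u₁, u₂)` that are jointly typical for the product laws `U₁ᵢ × U₂ᵢ` and
whose codewords `(L u₁ + b₁, L u₂ + b₂)` are jointly typical with `x`. Joint typicality of the index
words is stronger than what the codes ask for, but it is what keeps the number of collisions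
`s u₁ + t u₂ = s u₁' + t u₂'` at the exponential rate `H(U₁, U₂) - H(s U₁ + t U₂)`.

Two index pairs contribute to the variance only if the differences `u₁' - u₁` and `u₂' - u₂` are
linearly dependent. If both vanish, the contribution is small compared with the squared mean by the
bound on `∑ ρᵢ (H(U₁ᵢ) + H(U₂ᵢ))`; if they satisfy `s d₁ + t d₂ = 0`, it is small by the bound on
`∑ ρᵢ H(s U₁ᵢ + t U₂ᵢ)`, where `(s, t) = (1, 0)` and `(0, 1)` give the bounds for the single codes
(`card_miss_le`). The cardinalities of the typical sets come from the equipartition property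
(`IsTypical.exists_wordProb_eq_exp`) and the law of large numbers
(`tendsto_sum_wordProb_typical`). With strict bounds this gives good codes of every fixed parameter
(`eventually_exists_coverProb_ge_of_lt`), and a diagonal sequence lets the parameter tend to `0`
(`exists_existsCoveringNQLC`).

With non-strict bounds, slightly larger dimensions make all bounds strict unless all `U₁ᵢ`, or all
`U₂ᵢ`, are deterministic. If all `U₁ᵢ` are, the bound for the first code forces `V₁` to be uniform
and independent of `X`; the first code is then a single word that a suitable dither makes arbitrary,
and it may be regarded as part of the source that the second code has to cover
(`eventually_exists_of_deterministic_left`).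
-/


namespace NQLC

/-! ### Words, types and typical sets -/

section Types

open scoped Classical

variable {α β : Type*} {n : ℕ}

/-- The probability of the word `z` when its letters are drawn independently from `p`. -/
def wordProb (p : α → ℝ) (z : Fin n → α) : ℝ := ∏ j, p (z j)

lemma wordProb_nonneg {p : α → ℝ} (hp : ∀ a, 0 ≤ p a) (z : Fin n → α) : 0 ≤ wordProb p z :=
  Finset.prod_nonneg fun _ _ => hp _

lemma law_mem_stdSimplex [Fintype α] [Fintype β] {p : α → ℝ} (hp : p ∈ stdSimplex ℝ α)
    (f : α → β) : law p f ∈ stdSimplex ℝ β := by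
  refine ⟨fun b => Finset.sum_nonneg fun a _ => hp.1 a, ?_⟩
  rw [← hp.2]
  exact Finset.sum_fiberwise _ _ _

lemma le_law [Fintype α] {p : α → ℝ} (hp : ∀ a, 0 ≤ p a) (f : α → β) (a : α) :
    p a ≤ law p f (f a) :=
  Finset.single_le_sum (f := p) (fun a _ => hp a) (by simp)

lemma sum_wordProb [Fintype α] {p : α → ℝ} (hp : p ∈ stdSimplex ℝ α) :
    ∑ z : Fin n → α, wordProb p z = 1 := by
  have := Finset.prod_univ_sum (fun _ : Fin n => (Finset.univ : Finset α)) (fun _ a => p a)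
  simp only [hp.2, Finset.prod_const_one, Fintype.piFinset_univ] at this
  exact this.symm

/-- The image under `f`, letter by letter, of an i.i.d. word is an i.i.d. word. -/
lemma sum_wordProb_fiber [Fintype α] (p : α → ℝ) (f : α → β) (y : Fin n → β) :
    ∑ z : Fin n → α with f ∘ z = y, wordProb p z = wordProb (law p f) y := by
  have := Finset.prod_univ_sum (fun j : Fin n => (Finset.univ.filter fun a => f a = y j))
    (fun _ a => p a)
  unfold wordProb law
  rw [this]
  refine Finset.sum_congr ?_ fun _ _ => rfl
  ext z
  simp [funext_iff]

lemma sum_comp_eq_sum_occ [Fintype α] (z : Fin n → α) (g : α → ℝ) :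
    ∑ j, g (z j) = ∑ a, (occ z a : ℝ) * g a := by
  rw [← Finset.sum_fiberwise (s := Finset.univ) (g := z)]
  refine Finset.sum_congr rfl fun a _ => ?_
  rw [Finset.sum_congr rfl (g := fun _ => g a) (by simp +contextual)]
  simp [occ]

lemma occ_pos (z : Fin n → α) (j : Fin n) : 0 < occ z (z j) :=
  Finset.card_pos.2 ⟨j, by simp⟩

lemma IsTypical.mono {ε η : ℝ} {p : α → ℝ} (hp : ∀ a, 0 ≤ p a) (h : ε ≤ η) {z : Fin n → α}
    (hz : IsTypical ε p z) : IsTypical η p z := fun a =>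
  (hz a).trans (mul_le_mul_of_nonneg_right h (mul_nonneg n.cast_nonneg (hp a)))

lemma IsTypical.pos {ε : ℝ} {p : α → ℝ} (hp : ∀ a, 0 ≤ p a) {z : Fin n → α}
    (hz : IsTypical ε p z) (j : Fin n) : 0 < p (z j) := by
  refine (hp _).lt_of_ne fun h => ?_
  have := hz (z j)
  rw [← h] at this
  simp only [mul_zero, sub_zero, abs_nonpos_iff, Nat.cast_eq_zero] at this
  exact (occ_pos z j).ne' this

lemma occ_comp [Fintype α] (f : α → β) (z : Fin n → α) (b : β) :
    (occ (f ∘ z) b : ℝ) = ∑ a with f a = b, (occ z a : ℝ) := by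
  have := sum_comp_eq_sum_occ z (fun a => if f a = b then (1 : ℝ) else 0)
  simp only [mul_ite, mul_one, mul_zero, ← Finset.sum_filter] at this
  rw [← this]
  simp [occ]

lemma IsTypical.comp [Fintype α] {ε : ℝ} {p : α → ℝ} (f : α → β)
    {z : Fin n → α} (hz : IsTypical ε p z) : IsTypical ε (law p f) (f ∘ z) := by
  intro b
  rw [occ_comp, law, Finset.mul_sum, Finset.mul_sum, ← Finset.sum_sub_distrib]
  exact (Finset.abs_sum_le_sum_abs _ _).trans (Finset.sum_le_sum fun a _ => hz a)

lemma le_one_of_mem_stdSimplex [Fintype α] {p : α → ℝ} (hp : p ∈ stdSimplex ℝ α) (a : α) :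
    p a ≤ 1 := by
  rw [← hp.2]; exact Finset.single_le_sum (fun a _ => hp.1 a) (Finset.mem_univ a)

lemma entropy_nonneg [Fintype α] {p : α → ℝ} (hp : p ∈ stdSimplex ℝ α) : 0 ≤ entropy p :=
  Finset.sum_nonneg fun a _ => Real.negMulLog_nonneg (hp.1 a) (le_one_of_mem_stdSimplex hp a)

/-- Equipartition: a typical word has probability `exp (-n (1 ± ε) H(p))`. -/
lemma IsTypical.exists_wordProb_eq_exp [Fintype α] {ε : ℝ} {p : α → ℝ}
    (hp : p ∈ stdSimplex ℝ α) {z : Fin n → α} (hz : IsTypical ε p z) :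
    ∃ t : ℝ, wordProb p z = Real.exp t ∧ |t + n * entropy p| ≤ ε * (n * entropy p) := by
  refine ⟨∑ j, Real.log (p (z j)), ?_, ?_⟩
  · rw [Real.exp_sum]
    exact Finset.prod_congr rfl fun j _ => (Real.exp_log (hz.pos hp.1 j)).symm
  · rw [sum_comp_eq_sum_occ z fun a => Real.log (p a), entropy, Finset.mul_sum, Finset.mul_sum, ← Finset.sum_add_distrib]
    refine (Finset.abs_sum_le_sum_abs _ _).trans (Finset.sum_le_sum fun a _ => ?_)
    have hlog : Real.log (p a) ≤ 0 := Real.log_nonpos (hp.1 a) (le_one_of_mem_stdSimplex hp a)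
    have h1 : (occ z a : ℝ) * Real.log (p a) + n * Real.negMulLog (p a) =
        (occ z a - n * p a) * Real.log (p a) := by rw [Real.negMulLog]; ring
    have h2 : ε * (n * Real.negMulLog (p a)) = ε * (n * p a) * |Real.log (p a)| := by
      rw [abs_of_nonpos hlog, Real.negMulLog]; ring
    rw [h1, abs_mul, h2]
    exact mul_le_mul_of_nonneg_right (hz a) (abs_nonneg _)

lemma IsTypical.le_wordProb [Fintype α] {ε : ℝ} {p : α → ℝ} (hp : p ∈ stdSimplex ℝ α)
    {z : Fin n → α} (hz : IsTypical ε p z) :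
    Real.exp (-(n * ((1 + ε) * entropy p))) ≤ wordProb p z := by
  obtain ⟨t, h, ht⟩ := hz.exists_wordProb_eq_exp hp
  rw [h, Real.exp_le_exp]
  linarith [(abs_le.1 ht).1]

lemma IsTypical.wordProb_le [Fintype α] {ε : ℝ} {p : α → ℝ} (hp : p ∈ stdSimplex ℝ α)
    {z : Fin n → α} (hz : IsTypical ε p z) :
    wordProb p z ≤ Real.exp (-(n * ((1 - ε) * entropy p))) := by
  obtain ⟨t, h, ht⟩ := hz.exists_wordProb_eq_exp hp
  rw [h, Real.exp_le_exp]
  linarith [(abs_le.1 ht).2]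

/-- At most about `exp (n (H(Z) - H(f Z)))` typical words have a given image under `f`. -/
lemma card_typical_fiber_le [Fintype α] [Fintype β] {ε : ℝ} {p : α → ℝ}
    (hp : p ∈ stdSimplex ℝ α) (f : α → β) (y : Fin n → β) :
    ((Finset.univ.filter fun z : Fin n → α => IsTypical ε p z ∧ f ∘ z = y).card : ℝ) ≤
      Real.exp (n * ((1 + ε) * entropy p - (1 - ε) * entropy (law p f))) := by
  set S := Finset.univ.filter fun z : Fin n → α => IsTypical ε p z ∧ f ∘ z = y with hS
  rcases S.eq_empty_or_nonempty with h | ⟨z₀, hz₀⟩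
  · rw [h]; simpa using Real.exp_nonneg _
  · simp only [hS, Finset.mem_filter, Finset.mem_univ, true_and] at hz₀
    have hy : IsTypical ε (law p f) y := hz₀.2 ▸ hz₀.1.comp f
    have h1 : (S.card : ℝ) * Real.exp (-(n * ((1 + ε) * entropy p))) ≤ wordProb (law p f) y := by
      rw [← sum_wordProb_fiber, ← nsmul_eq_mul]
      refine (Finset.card_nsmul_le_sum S _ _ fun z hz => ?_).trans
        (Finset.sum_le_sum_of_subset_of_nonneg ?_ fun z _ _ => wordProb_nonneg hp.1 z)
      · exact IsTypical.le_wordProb hp (by simpa [hS] using (Finset.mem_filter.1 hz).2.1)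
      · intro z hz
        simpa using (Finset.mem_filter.1 hz).2.2
    have h2 := h1.trans (hy.wordProb_le (law_mem_stdSimplex hp f))
    rw [← le_div_iff₀ (Real.exp_pos _), ← Real.exp_sub] at h2
    refine h2.trans (Real.exp_le_exp.2 (le_of_eq ?_))
    ring

/-- If at least half of the fibre over `y` is typical, in terms of conditional probability, then
about `exp (n (H(Z) - H(f Z)))` typical words lie over `y`. -/
lemma le_card_typical_fiber [Fintype α] [Fintype β] {ε : ℝ} {p : α → ℝ}
    (hp : p ∈ stdSimplex ℝ α) (f : α → β) (y : Fin n → β) (hy0 : 0 < wordProb (law p f) y)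
    (hy : wordProb (law p f) y / 2 ≤
      ∑ z : Fin n → α with IsTypical ε p z ∧ f ∘ z = y, wordProb p z) :
    Real.exp (n * ((1 - ε) * entropy p - (1 + ε) * entropy (law p f))) / 2 ≤
      ((Finset.univ.filter fun z : Fin n → α => IsTypical ε p z ∧ f ∘ z = y).card : ℝ) := by
  set S := Finset.univ.filter fun z : Fin n → α => IsTypical ε p z ∧ f ∘ z = y with hS
  have hne : S.Nonempty := by
    rw [Finset.nonempty_iff_ne_empty]
    intro h
    rw [h, Finset.sum_empty] at hy
    linarith
  obtain ⟨z₀, hz₀⟩ := hne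
  simp only [hS, Finset.mem_filter, Finset.mem_univ, true_and] at hz₀
  have hyt : IsTypical ε (law p f) y := hz₀.2 ▸ hz₀.1.comp f
  have h1 : ∑ z ∈ S, wordProb p z ≤ S.card * Real.exp (-(n * ((1 - ε) * entropy p))) := by
    rw [← nsmul_eq_mul]
    exact Finset.sum_le_card_nsmul S _ _ fun z hz =>
      IsTypical.wordProb_le hp (Finset.mem_filter.1 hz).2.1
  have h2 := hyt.le_wordProb (law_mem_stdSimplex hp f)
  have h3 : Real.exp (-(n * ((1 + ε) * entropy (law p f)))) / 2 ≤
      S.card * Real.exp (-(n * ((1 - ε) * entropy p))) := by linarith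
  rw [← div_le_iff₀ (Real.exp_pos _), div_right_comm, ← Real.exp_sub] at h3
  refine le_trans (le_of_eq ?_) h3
  congr 2
  ring

end Types

/-! ### The weak law of large numbers for types -/

section AEP

open scoped Classical

variable {α : Type*} [Fintype α]

lemma sum_wordProb_cons {n : ℕ} (p : α → ℝ) (φ : (Fin (n + 1) → α) → ℝ) :
    ∑ z : Fin (n + 1) → α, wordProb p z * φ z =
      ∑ a, p a * ∑ z : Fin n → α, wordProb p z * φ (Fin.cons a z) := by
  rw [← (Fin.consEquiv fun _ => α).sum_comp, Fintype.sum_prod_type]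
  refine Finset.sum_congr rfl fun a _ => ?_
  rw [Finset.mul_sum]
  refine Finset.sum_congr rfl fun z _ => ?_
  simp [wordProb, Fin.prod_univ_succ, Fin.consEquiv, mul_assoc]

lemma sum_wordProb_sum_eq_zero {p : α → ℝ} (hp : p ∈ stdSimplex ℝ α) {g : α → ℝ}
    (hg : ∑ a, p a * g a = 0) (n : ℕ) :
    ∑ z : Fin n → α, wordProb p z * ∑ j, g (z j) = 0 := by
  induction n with
  | zero => simp
  | succ n ih =>
    rw [sum_wordProb_cons]
    simp only [Fin.sum_univ_succ, Fin.cons_zero, Fin.cons_succ, mul_add, Finset.sum_add_distrib,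
      ih, ← Finset.sum_mul, sum_wordProb hp, one_mul, hg, add_zero]

/-- The variance of a sum of independent centred variables. -/
lemma sum_wordProb_sum_sq {p : α → ℝ} (hp : p ∈ stdSimplex ℝ α) {g : α → ℝ}
    (hg : ∑ a, p a * g a = 0) (n : ℕ) :
    ∑ z : Fin n → α, wordProb p z * (∑ j, g (z j)) ^ 2 = n * ∑ a, p a * g a ^ 2 := by
  induction n with
  | zero => simp
  | succ n ih =>
    rw [sum_wordProb_cons]
    have h : ∀ a, ∑ z : Fin n → α, wordProb p z * (∑ j, g ((Fin.cons a z : Fin (n+1) → α) j)) ^ 2 =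
        g a ^ 2 + n * ∑ a, p a * g a ^ 2 := by
      intro a
      have h0 := sum_wordProb_sum_eq_zero hp hg n
      have h1 : ∀ z : Fin n → α,
          wordProb p z * (∑ j, g ((Fin.cons a z : Fin (n+1) → α) j)) ^ 2 =
          wordProb p z * g a ^ 2 + 2 * g a * (wordProb p z * ∑ j, g (z j)) +
            wordProb p z * (∑ j, g (z j)) ^ 2 := by
        intro z
        simp only [Fin.sum_univ_succ, Fin.cons_zero, Fin.cons_succ]
        ring
      simp only [h1, Finset.sum_add_distrib, ← Finset.mul_sum, h0, ih, ← Finset.sum_mul,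
        sum_wordProb hp]
      ring
    simp only [h, mul_add, Finset.sum_add_distrib, ← Finset.sum_mul, hp.2]
    push_cast
    ring

lemma sum_wordProb_not_typical_letter_le {p : α → ℝ} (hp : p ∈ stdSimplex ℝ α) {ε : ℝ}
    (hε : 0 < ε) (a : α) {n : ℕ} (hn : 0 < n) :
    ∑ z : Fin n → α with ¬ |(occ z a : ℝ) - n * p a| ≤ ε * (n * p a), wordProb p z ≤
      ((p a) * ε ^ 2)⁻¹ * (n : ℝ)⁻¹ := by
  have hn' : (0 : ℝ) < n := by exact_mod_cast hn
  rcases (hp.1 a).eq_or_lt with h0 | h0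
  · -- a letter of probability zero does not occur
    refine (Finset.sum_eq_zero fun z hz => ?_).le.trans (by rw [← h0]; simp)
    rw [Finset.mem_filter, ← h0] at hz
    have : occ z a ≠ 0 := by
      intro h
      simp [h] at hz
    obtain ⟨j, hj⟩ := Finset.card_pos.1 (Nat.pos_of_ne_zero this)
    simp only [Finset.mem_filter, Finset.mem_univ, true_and] at hj
    exact Finset.prod_eq_zero (Finset.mem_univ j) (by rw [hj, ← h0])
  · set g : α → ℝ := fun b => (if b = a then 1 else 0) - p a with hgdef
    have hg : ∑ b, p b * g b = 0 := by
      simp [hgdef, mul_sub, ← Finset.sum_mul, hp.2]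
    have hocc : ∀ z : Fin n → α, ∑ j, g (z j) = (occ z a : ℝ) - n * p a := by
      intro z
      simp [hgdef, occ]
    have hv : ∑ b, p b * g b ^ 2 ≤ p a := by
      have h1 : ∀ b, p b * g b ^ 2 =
          p b * (if b = a then 1 else 0) * (1 - 2 * p a) + p b * p a ^ 2 := by
        intro b
        simp only [hgdef]
        split_ifs <;> ring
      simp only [h1, Finset.sum_add_distrib, ← Finset.sum_mul, hp.2]
      simp
      nlinarith
    have hvar := sum_wordProb_sum_sq hp hg n
    set S := Finset.univ.filter fun z : Fin n → α => ¬ |(occ z a : ℝ) - n * p a| ≤ ε * (n * p a)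
    have h2 : (ε * (n * p a)) ^ 2 * ∑ z ∈ S, wordProb p z ≤ n * p a := by
      rw [Finset.mul_sum]
      calc _ ≤ ∑ z ∈ S, wordProb p z * (∑ j, g (z j)) ^ 2 := by
            refine Finset.sum_le_sum fun z hz => ?_
            rw [mul_comm]
            refine mul_le_mul_of_nonneg_left ?_ (wordProb_nonneg hp.1 z)
            rw [hocc, ← sq_abs ((occ z a : ℝ) - n * p a)]
            have := (not_le.1 (Finset.mem_filter.1 hz).2).le
            exact pow_le_pow_left₀ (by positivity) this 2
        _ ≤ ∑ z, wordProb p z * (∑ j, g (z j)) ^ 2 :=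
            Finset.sum_le_sum_of_subset_of_nonneg (Finset.subset_univ _) fun z _ _ =>
              mul_nonneg (wordProb_nonneg hp.1 z) (sq_nonneg _)
        _ ≤ n * p a := by
            rw [hvar]
            exact mul_le_mul_of_nonneg_left hv hn'.le
    rw [← mul_inv, ← one_div, le_div_iff₀ (by positivity)]
    have h3 : 0 < (n : ℝ) * p a := by positivity
    nlinarith

/-- Asymptotic equipartition: an i.i.d. word is typical with probability tending to `1`. -/
lemma tendsto_sum_wordProb_typical {p : α → ℝ} (hp : p ∈ stdSimplex ℝ α) {ε : ℝ} (hε : 0 < ε) :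
    Tendsto (fun n => ∑ z : Fin n → α with IsTypical ε p z, wordProb p z) atTop (𝓝 1) := by
  have hlow : ∀ᶠ n : ℕ in atTop, 1 - (∑ a, ((p a) * ε ^ 2)⁻¹) * (n : ℝ)⁻¹ ≤
      ∑ z : Fin n → α with IsTypical ε p z, wordProb p z := by
    filter_upwards [eventually_gt_atTop 0] with n hn
    have h1 := Finset.sum_filter_add_sum_filter_not Finset.univ
      (fun z : Fin n → α => IsTypical ε p z) (wordProb p)
    rw [sum_wordProb hp] at h1
    have h2 : ∑ z : Fin n → α with ¬ IsTypical ε p z, wordProb p z ≤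
        ∑ a, ∑ z : Fin n → α with ¬ |(occ z a : ℝ) - n * p a| ≤ ε * (n * p a), wordProb p z := by
      simp only [Finset.sum_filter]
      rw [Finset.sum_comm]
      refine Finset.sum_le_sum fun z _ => ?_
      have h0 : ∀ a, 0 ≤ if ¬ |(occ z a : ℝ) - n * p a| ≤ ε * (n * p a) then wordProb p z else 0 :=
        fun a => by split_ifs <;> simp [wordProb_nonneg hp.1 z]
      by_cases hz : IsTypical ε p z
      · rw [if_neg (not_not.2 hz)]
        exact Finset.sum_nonneg fun a _ => h0 a
      · obtain ⟨a, ha⟩ := not_forall.1 hz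
        rw [if_pos hz]
        refine le_trans ?_ (Finset.single_le_sum (fun a _ => h0 a) (Finset.mem_univ a))
        rw [if_pos ha]
    have h3 := Finset.sum_le_sum fun a (_ : a ∈ Finset.univ) =>
      sum_wordProb_not_typical_letter_le hp hε a hn
    rw [← Finset.sum_mul] at h3
    linarith
  have hlim : Tendsto (fun n : ℕ => 1 - (∑ a, ((p a) * ε ^ 2)⁻¹) * (n : ℝ)⁻¹) atTop (𝓝 1) := by
    have := (tendsto_inv_atTop_nhds_zero_nat (𝕜 := ℝ)).const_mul (∑ a, ((p a) * ε ^ 2)⁻¹)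
    simpa using this.const_sub 1
  refine tendsto_of_tendsto_of_tendsto_of_le_of_le' hlim tendsto_const_nhds hlow ?_
  refine Eventually.of_forall fun n => ?_
  rw [← sum_wordProb (n := n) hp]
  exact Finset.sum_le_sum_of_subset_of_nonneg (Finset.subset_univ _)
    fun z _ _ => wordProb_nonneg hp.1 z

/-- For all but a small part of the words `y`, at least half of the fibre over `y` is typical. -/
lemma sum_wordProb_bad_fiber_le {β : Type*} [Fintype β] {p : α → ℝ} (hp : p ∈ stdSimplex ℝ α)
    (f : α → β) (ε : ℝ) (n : ℕ) :
    ∑ y : Fin n → β with ¬ (0 < wordProb (law p f) y ∧ wordProb (law p f) y / 2 ≤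
        ∑ z : Fin n → α with IsTypical ε p z ∧ f ∘ z = y, wordProb p z), wordProb (law p f) y ≤
      2 * (1 - ∑ z : Fin n → α with IsTypical ε p z, wordProb p z) := by
  have hq := law_mem_stdSimplex hp f
  have key : ∀ y : Fin n → β, ∑ z : Fin n → α with IsTypical ε p z ∧ f ∘ z = y, wordProb p z ≤
      wordProb (law p f) y := by
    intro y
    rw [← sum_wordProb_fiber]
    refine Finset.sum_le_sum_of_subset_of_nonneg ?_ fun z _ _ => wordProb_nonneg hp.1 z
    intro z hz
    simp only [Finset.mem_filter] at hz ⊢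
    exact ⟨hz.1, hz.2.2⟩
  have htot : ∑ y : Fin n → β, ∑ z : Fin n → α with IsTypical ε p z ∧ f ∘ z = y, wordProb p z =
      ∑ z : Fin n → α with IsTypical ε p z, wordProb p z := by
    rw [← Finset.sum_fiberwise (Finset.univ.filter _) (fun z => f ∘ z)]
    simp only [Finset.filter_filter]
  calc _ ≤ ∑ y : Fin n → β with ¬ (0 < wordProb (law p f) y ∧ wordProb (law p f) y / 2 ≤
        ∑ z : Fin n → α with IsTypical ε p z ∧ f ∘ z = y, wordProb p z),
          2 * (wordProb (law p f) y -
            ∑ z : Fin n → α with IsTypical ε p z ∧ f ∘ z = y, wordProb p z) := by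
        refine Finset.sum_le_sum fun y hy => ?_
        have hy := (Finset.mem_filter.1 hy).2
        have := key y
        by_cases h0 : 0 < wordProb (law p f) y
        · have := not_le.1 fun h => hy ⟨h0, h⟩
          linarith
        · have h1 := wordProb_nonneg hq.1 y
          linarith
    _ ≤ ∑ y, 2 * (wordProb (law p f) y -
            ∑ z : Fin n → α with IsTypical ε p z ∧ f ∘ z = y, wordProb p z) :=
        Finset.sum_le_sum_of_subset_of_nonneg (Finset.subset_univ _) fun y _ _ => by
          linarith [key y]
    _ = _ := by
        rw [← Finset.mul_sum, Finset.sum_sub_distrib, sum_wordProb hq, htot]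

end AEP

/-! ### Second moment bound for a random affine image -/

section SecondMoment

open scoped Classical

lemma card_preimage_mul_card {A B : Type*} [AddGroup A] [Fintype A] [AddGroup B] [Fintype B]
    (φ : A →+ B) (hφ : Function.Surjective φ) (S : Finset B) :
    (Finset.univ.filter fun g => φ g ∈ S).card * Fintype.card B = S.card * Fintype.card A := by
  have h1 : ∀ y : B, (Finset.univ.filter fun g => φ g = y).card =
      (Finset.univ.filter fun g => φ g = 0).card := fun y =>
    AddMonoidHom.card_fiber_eq_of_mem_range φ (hφ y) (hφ 0)
  have h2 : Fintype.card A = Fintype.card B * (Finset.univ.filter fun g => φ g = 0).card := by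
    rw [← Finset.card_univ, Finset.card_eq_sum_card_fiberwise (f := φ) (t := Finset.univ) (by simp)]
    simp [h1]
  have h3 : (Finset.univ.filter fun g => φ g ∈ S).card =
      S.card * (Finset.univ.filter fun g => φ g = 0).card := by
    rw [Finset.card_eq_sum_card_fiberwise (f := φ) (t := S) (by intro x; simp)]
    rw [Finset.sum_congr rfl (g := fun _ => (Finset.univ.filter fun g => φ g = 0).card)]
    · simp
    · intro y hy
      rw [← h1 y]
      congr 1
      ext g
      simp only [Finset.mem_filter, Finset.mem_univ, true_and]
      exact ⟨fun h => h.2, fun h => ⟨h ▸ hy, h⟩⟩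
  rw [h3, h2]
  ring

variable {F E W : Type*} [Field F] [AddCommGroup E] [Module F E] [AddCommGroup W] [Module F W]

/-- Evaluation of linear maps at the vector `d`, as an additive map. -/
def evalHom (d : E) : (E →ₗ[F] W) →+ W where
  toFun L := L d
  map_zero' := rfl
  map_add' _ _ := rfl

lemma exists_linearMap_apply_eq {κ : Type*} {v : κ → E} (hv : LinearIndependent F v) (y : κ → W) :
    ∃ L : E →ₗ[F] W, ∀ i, L (v i) = y i := by
  obtain ⟨g, hg⟩ := (Finsupp.linearCombination F v).exists_leftInverse_of_injective
    (LinearMap.ker_eq_bot.2 hv)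
  refine ⟨(Finsupp.linearCombination F y).comp g, fun i => ?_⟩
  have h := LinearMap.congr_fun hg (Finsupp.single i 1)
  simp only [LinearMap.comp_apply, Finsupp.linearCombination_single, one_smul,
    LinearMap.id_apply] at h
  simp [h]

lemma evalHom_surjective {d : E} (hd : d ≠ 0) :
    Function.Surjective (evalHom (F := F) (W := W) d) := by
  intro y
  obtain ⟨L, hL⟩ := exists_linearMap_apply_eq
    (LinearIndependent.of_subsingleton (R := F) (v := fun _ : Unit => d) () hd) (fun _ => y)
  exact ⟨L, hL ()⟩

lemma evalHom_prod_surjective {d₁ d₂ : E} (h : LinearIndependent F ![d₁, d₂]) :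
    Function.Surjective ((evalHom (F := F) (W := W) d₁).prod (evalHom d₂)) := by
  rintro ⟨y₁, y₂⟩
  obtain ⟨L, hL⟩ := exists_linearMap_apply_eq h ![y₁, y₂]
  exact ⟨L, Prod.ext (hL 0) (hL 1)⟩

/-- The directions in which a pair of codewords can collide: a nonzero pair `(d₁, d₂)` of linearly
dependent vectors satisfies `s d₁ + t d₂ = 0` for one of these `(s, t)`. -/
def IsDirection (c : F × F) : Prop :=
  c = (1, 0) ∨ c = (0, 1) ∨ (c.1 ≠ 0 ∧ c.2 ≠ 0)

lemma exists_isDirection_of_not_linearIndependent {d₁ d₂ : E}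
    (h : ¬ LinearIndependent F ![d₁, d₂]) :
    ∃ c : F × F, IsDirection c ∧ c.1 • d₁ + c.2 • d₂ = 0 := by
  rw [LinearIndependent.pair_iff] at h
  push Not at h
  obtain ⟨s, t, hst, hne⟩ := h
  by_cases hs : s = 0
  · subst hs
    have ht := hne rfl
    refine ⟨(0, 1), Or.inr (Or.inl rfl), ?_⟩
    simpa [ht] using hst
  · by_cases ht : t = 0
    · subst ht
      refine ⟨(1, 0), Or.inl rfl, ?_⟩
      simpa [hs] using hst
    · exact ⟨(s, t), Or.inr (Or.inr ⟨hs, ht⟩), hst⟩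

variable [Fintype F] [Fintype W] [Fintype (E →ₗ[F] W)]

/-- The number of linear maps `L` for which `(v₁ + L d₁, v₂ + L d₂)` lies in `T`: three cases,
according to the rank of the family `(d₁, d₂)`. -/
lemma card_linearMap_le (T : Finset (W × W)) (MT : F × F → ℝ)
    (hMT : ∀ c, IsDirection c → ∀ w,
      ((T.filter fun v => c.1 • v.1 + c.2 • v.2 = w).card : ℝ) ≤ MT c)
    (d₁ d₂ : E) (v : W × W) :
    ((Finset.univ.filter fun L : E →ₗ[F] W => (v.1 + L d₁, v.2 + L d₂) ∈ T).card : ℝ) ≤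
      Fintype.card (E →ₗ[F] W) * (T.card / (Fintype.card W : ℝ) ^ 2 +
        (if d₁ = 0 ∧ d₂ = 0 then 1 else 0) +
        ∑ c : F × F with IsDirection c,
          (if c.1 • d₁ + c.2 • d₂ = 0 then MT c / Fintype.card W else 0)) := by
  have hQ : (0 : ℝ) < Fintype.card W := by exact_mod_cast Fintype.card_pos
  have hMT0 : ∀ c, IsDirection c → 0 ≤ MT c := fun c hc =>
    (Nat.cast_nonneg _).trans (hMT c hc 0)
  have hsum0 : ∀ c ∈ Finset.univ.filter (fun c : F × F => IsDirection c),
      0 ≤ if c.1 • d₁ + c.2 • d₂ = 0 then MT c / (Fintype.card W : ℝ) else 0 := by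
    intro c hc
    split_ifs
    · exact div_nonneg (hMT0 c (Finset.mem_filter.1 hc).2) hQ.le
    · exact le_rfl
  have hT0 : (0 : ℝ) ≤ T.card / (Fintype.card W : ℝ) ^ 2 := by positivity
  by_cases h0 : d₁ = 0 ∧ d₂ = 0
  · rw [if_pos h0]
    have h1 : ((Finset.univ.filter fun L : E →ₗ[F] W => (v.1 + L d₁, v.2 + L d₂) ∈ T).card : ℝ) ≤
        Fintype.card (E →ₗ[F] W) := by exact_mod_cast Finset.card_le_univ _
    refine h1.trans (le_mul_of_one_le_right (Nat.cast_nonneg _) ?_)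
    linarith [Finset.sum_nonneg hsum0]
  rw [if_neg h0, add_zero]
  by_cases hli : LinearIndependent F ![d₁, d₂]
  · have h1 := card_preimage_mul_card _ (evalHom_prod_surjective (W := W) hli)
      (T.map (Equiv.addRight (-v)).toEmbedding)
    rw [Finset.card_map] at h1
    have h2 : (Finset.univ.filter fun L : E →ₗ[F] W => (v.1 + L d₁, v.2 + L d₂) ∈ T) =
        Finset.univ.filter fun L : E →ₗ[F] W => ((evalHom (F := F) (W := W) d₁).prod (evalHom d₂)) L
          ∈ T.map (Equiv.addRight (-v)).toEmbedding := by
      ext L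
      simp only [Finset.mem_filter, Finset.mem_univ, true_and, Finset.mem_map_equiv]
      have : (Equiv.addRight (-v)).symm (((evalHom (F := F) (W := W) d₁).prod (evalHom d₂)) L) =
          (v.1 + L d₁, v.2 + L d₂) := by
        ext <;> simp [evalHom, add_comm]
      rw [this]
    rw [h2]
    have h3 : ((Finset.univ.filter fun L : E →ₗ[F] W => ((evalHom (F := F) (W := W) d₁).prod
        (evalHom d₂)) L ∈ T.map (Equiv.addRight (-v)).toEmbedding).card : ℝ) =
        Fintype.card (E →ₗ[F] W) * (T.card / (Fintype.card W : ℝ) ^ 2) := by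
      rw [mul_div_assoc', eq_div_iff (by positivity)]
      rw [Fintype.card_prod] at h1
      have : ((_ * (Fintype.card W * Fintype.card W) : ℕ) : ℝ) = _ := congrArg Nat.cast h1
      push_cast at this
      rw [sq, mul_comm (Fintype.card (E →ₗ[F] W) : ℝ), ← this]
      congr!
    rw [h3]
    exact mul_le_mul_of_nonneg_left (by linarith [Finset.sum_nonneg hsum0]) (Nat.cast_nonneg _)
  · obtain ⟨c, hc, hcd⟩ := exists_isDirection_of_not_linearIndependent hli
    -- one of the two vectors is nonzero, and evaluation there determines the translate
    have hfib : ∀ v' : W × W, ((Finset.univ.filter fun L : E →ₗ[F] W =>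
        (v.1 + L d₁, v.2 + L d₂) = v').card : ℝ) ≤
        Fintype.card (E →ₗ[F] W) / Fintype.card W := by
      intro v'
      rw [le_div_iff₀ hQ]
      rcases not_and_or.1 h0 with hd | hd
      · have h1 := card_preimage_mul_card _ (evalHom_surjective (F := F) (W := W) hd) {v'.1 - v.1}
        rw [Finset.card_singleton, one_mul] at h1
        rw [← h1]
        push_cast
        refine mul_le_mul_of_nonneg_right (Nat.cast_le.2 (Finset.card_le_card ?_)) hQ.le
        intro L
        simp only [Finset.mem_filter, Finset.mem_univ, true_and, Finset.mem_singleton]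
        rintro rfl
        simp [evalHom]
      · have h1 := card_preimage_mul_card _ (evalHom_surjective (F := F) (W := W) hd) {v'.2 - v.2}
        rw [Finset.card_singleton, one_mul] at h1
        rw [← h1]
        push_cast
        refine mul_le_mul_of_nonneg_right (Nat.cast_le.2 (Finset.card_le_card ?_)) hQ.le
        intro L
        simp only [Finset.mem_filter, Finset.mem_univ, true_and, Finset.mem_singleton]
        rintro rfl
        simp [evalHom]
    have h1 : ((Finset.univ.filter fun L : E →ₗ[F] W => (v.1 + L d₁, v.2 + L d₂) ∈ T).card : ℝ) ≤
        Fintype.card (E →ₗ[F] W) * (MT c / Fintype.card W) := by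
      set T' := T.filter fun v' => c.1 • v'.1 + c.2 • v'.2 = c.1 • v.1 + c.2 • v.2
      rw [Finset.card_eq_sum_card_fiberwise (f := fun L : E →ₗ[F] W => (v.1 + L d₁, v.2 + L d₂))
        (t := T')]
      · push_cast
        have h2 : ∀ v' ∈ T', (((Finset.univ.filter fun L : E →ₗ[F] W =>
            (v.1 + L d₁, v.2 + L d₂) ∈ T).filter fun L => (v.1 + L d₁, v.2 + L d₂) = v').card : ℝ) ≤
            Fintype.card (E →ₗ[F] W) / Fintype.card W := fun v' _ => by
          refine le_trans (Nat.cast_le.2 (Finset.card_le_card ?_)) (hfib v')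
          intro L
          simp only [Finset.mem_filter, Finset.mem_univ, true_and]
          exact fun h => h.2
        refine (Finset.sum_le_card_nsmul _ _ _ h2).trans ?_
        rw [nsmul_eq_mul, mul_div_assoc', div_eq_mul_inv, div_eq_mul_inv, ← mul_assoc,
          mul_comm (T'.card : ℝ)]
        exact mul_le_mul_of_nonneg_right (mul_le_mul_of_nonneg_left (hMT c hc _)
          (Nat.cast_nonneg _)) (inv_nonneg.2 hQ.le)
      · intro L hL
        simp only [Finset.coe_filter, Finset.mem_univ, true_and, Set.mem_ofPred_eq] at hL
        simp only [T', Finset.coe_filter, Set.mem_ofPred_eq]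
        refine ⟨hL, ?_⟩
        have := congrArg L hcd
        simp only [map_add, map_smul, map_zero] at this
        rw [smul_add, smul_add, add_add_add_comm, this, add_zero]
    refine h1.trans (mul_le_mul_of_nonneg_left ?_ (Nat.cast_nonneg _))
    have h2 := Finset.single_le_sum hsum0 (Finset.mem_filter.2 ⟨Finset.mem_univ c, hc⟩)
    rw [if_pos hcd] at h2
    linarith

/-- A family of index pairs `(a₁ b, a₂ b)`, `b ∈ B`, is mapped by a uniformly random linear map `L`
and independent uniform shifts `c₁`, `c₂`. By Chebyshev's inequality the probability that no image
`(L (a₁ b) + c₁, L (a₂ b) + c₂)` lies in `T` is at most the variance over the squared mean of the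
number of such `b`; only pairs `b`, `b'` whose differences are linearly dependent contribute to the
variance. -/
lemma card_miss_le {ι : Type*} [Fintype ι] (B : Finset ι) (a₁ a₂ : ι → E)
    (hinj : ∀ b b', a₁ b = a₁ b' → a₂ b = a₂ b' → b = b')
    (T : Finset (W × W)) (hB : B.Nonempty) (hT : T.Nonempty) (MB MT : F × F → ℝ)
    (hMB : ∀ c, IsDirection c → ∀ e,
      ((B.filter fun b => c.1 • a₁ b + c.2 • a₂ b = e).card : ℝ) ≤ MB c)
    (hMT : ∀ c, IsDirection c → ∀ w,
      ((T.filter fun v => c.1 • v.1 + c.2 • v.2 = w).card : ℝ) ≤ MT c) :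
    ((Finset.univ.filter fun ω : (E →ₗ[F] W) × (W × W) =>
      ∀ b ∈ B, (ω.1 (a₁ b) + ω.2.1, ω.1 (a₂ b) + ω.2.2) ∉ T).card : ℝ) ≤
    Fintype.card ((E →ₗ[F] W) × (W × W)) *
      ((Fintype.card W : ℝ) ^ 2 / (B.card * T.card) +
        ∑ c : F × F with IsDirection c, Fintype.card W * MB c * MT c / (B.card * T.card)) := by
  set H : ℝ := (Fintype.card (E →ₗ[F] W) : ℝ) with hH
  set Q : ℝ := (Fintype.card W : ℝ) with hQdef
  have hH0 : 0 < H := by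
    rw [hH]; exact_mod_cast Fintype.card_pos
  have hQ : 0 < Q := by
    rw [hQdef]; exact_mod_cast Fintype.card_pos
  have hBc : (0 : ℝ) < B.card := by exact_mod_cast hB.card_pos
  have hTc : (0 : ℝ) < T.card := by exact_mod_cast hT.card_pos
  set X : ι → (E →ₗ[F] W) × (W × W) → ℝ := fun b ω =>
    if (ω.1 (a₁ b) + ω.2.1, ω.1 (a₂ b) + ω.2.2) ∈ T then 1 else 0 with hX
  -- translating the shifts by the image of the index pair `b` turns the codeword into a free variable
  let σ : ι → (E →ₗ[F] W) × (W × W) ≃ (E →ₗ[F] W) × (W × W) := fun b =>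
    { toFun := fun ω => (ω.1, (ω.2.1 - ω.1 (a₁ b), ω.2.2 - ω.1 (a₂ b)))
      invFun := fun ω => (ω.1, (ω.2.1 + ω.1 (a₁ b), ω.2.2 + ω.1 (a₂ b)))
      left_inv := fun ω => by simp
      right_inv := fun ω => by simp }
  have hXσ : ∀ b b' L v, X b' (σ b (L, v)) =
      if (v.1 + L (a₁ b' - a₁ b), v.2 + L (a₂ b' - a₂ b)) ∈ T then 1 else 0 := by
    intro b b' L v
    have : (L (a₁ b') + (v.1 - L (a₁ b)), L (a₂ b') + (v.2 - L (a₂ b))) =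
        (v.1 + L (a₁ b' - a₁ b), v.2 + L (a₂ b' - a₂ b)) := by
      ext <;> simp only [map_sub] <;> abel
    simp only [hX, σ, Equiv.coe_fn_mk, this]
  have hXσ' : ∀ b L v, X b (σ b (L, v)) = if v ∈ T then 1 else 0 := by
    intro b L v
    rw [hXσ]
    simp
  have hS1 : ∀ b, ∑ ω, X b ω = H * T.card := by
    intro b
    rw [← (σ b).sum_comp, Fintype.sum_prod_type]
    simp only [hXσ', Finset.sum_ite_mem, Finset.univ_inter, Finset.sum_const, nsmul_eq_mul,
      mul_one, Finset.card_univ]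
    rfl
  have hS2 : ∀ b b', ∑ ω, X b ω * X b' ω ≤ T.card * (H * (T.card / Q ^ 2 +
        (if b = b' then 1 else 0) +
        ∑ c : F × F with IsDirection c,
          (if c.1 • a₁ b' + c.2 • a₂ b' = c.1 • a₁ b + c.2 • a₂ b then MT c / Q else 0))) := by
    intro b b'
    rw [← (σ b).sum_comp, Fintype.sum_prod_type_right]
    simp only [hXσ', ite_mul, one_mul, zero_mul, hXσ]
    have h1 : ∀ v : W × W, (∑ L : E →ₗ[F] W, if v ∈ T then
        (if (v.1 + L (a₁ b' - a₁ b), v.2 + L (a₂ b' - a₂ b)) ∈ T then (1 : ℝ) else 0) else 0) =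
        if v ∈ T then ((Finset.univ.filter fun L : E →ₗ[F] W =>
          (v.1 + L (a₁ b' - a₁ b), v.2 + L (a₂ b' - a₂ b)) ∈ T).card : ℝ) else 0 := by
      intro v
      split_ifs <;> simp
    simp only [h1, Finset.sum_ite_mem, Finset.univ_inter]
    refine (Finset.sum_le_card_nsmul _ _ _ fun v _ =>
      card_linearMap_le T MT hMT (a₁ b' - a₁ b) (a₂ b' - a₂ b) v).trans ?_
    rw [nsmul_eq_mul]
    refine le_of_eq ?_
    congr 5
    · refine propext ⟨fun h => hinj b b' (sub_eq_zero.1 h.1).symm (sub_eq_zero.1 h.2).symm, ?_⟩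
      rintro rfl
      simp
    · funext c
      congr 1
      rw [← sub_eq_zero (a := c.1 • a₁ b' + c.2 • a₂ b'), smul_sub, smul_sub, add_sub_add_comm]
  set N : (E →ₗ[F] W) × (W × W) → ℝ := fun ω => ∑ b ∈ B, X b ω with hN
  have hN1 : ∑ ω, N ω = B.card * (H * T.card) := by
    simp only [hN]
    rw [Finset.sum_comm]
    simp [hS1]
  set V₀ : ℝ := ∑ c : F × F with IsDirection c, MB c * MT c / Q with hV
  have hN2 : ∑ ω, N ω ^ 2 ≤ B.card * (T.card * (H * (B.card * (T.card / Q ^ 2) + 1 + V₀))) := by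
    have h1 : ∑ ω, N ω ^ 2 = ∑ b ∈ B, ∑ b' ∈ B, ∑ ω, X b ω * X b' ω := by
      simp only [hN, sq, Finset.sum_mul_sum]
      refine Finset.sum_comm.trans (Finset.sum_congr rfl fun b _ => ?_)
      exact Finset.sum_comm
    rw [h1, ← nsmul_eq_mul]
    refine Finset.sum_le_card_nsmul _ _ _ fun b hb => ?_
    refine (Finset.sum_le_sum (s := B) fun b' _ => hS2 b b').trans ?_
    rw [← Finset.mul_sum, ← Finset.mul_sum]
    refine mul_le_mul_of_nonneg_left (mul_le_mul_of_nonneg_left ?_ hH0.le) hTc.le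
    rw [Finset.sum_add_distrib, Finset.sum_add_distrib, Finset.sum_const, nsmul_eq_mul,
      Finset.sum_ite_eq, if_pos hb]
    refine add_le_add le_rfl ?_
    rw [Finset.sum_comm]
    refine Finset.sum_le_sum fun c hc => ?_
    have hc' := (Finset.mem_filter.1 hc).2
    rw [← Finset.sum_filter, Finset.sum_const, nsmul_eq_mul, mul_div_assoc]
    exact mul_le_mul_of_nonneg_right (hMB c hc' _)
      (div_nonneg ((Nat.cast_nonneg _).trans (hMT c hc' 0)) hQ.le)
  set μ : ℝ := B.card * T.card / Q ^ 2 with hμ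
  have hμ0 : 0 < μ := by positivity
  have hΩ : (Fintype.card ((E →ₗ[F] W) × (W × W)) : ℝ) = H * Q ^ 2 := by
    rw [Fintype.card_prod, Fintype.card_prod]
    push_cast
    rw [sq]
  have hvar : ∑ ω, (N ω - μ) ^ 2 ≤ B.card * (T.card * (H * (1 + V₀))) := by
    have h1 : ∑ ω, (N ω - μ) ^ 2 = ∑ ω, N ω ^ 2 - 2 * μ * ∑ ω, N ω + H * Q ^ 2 * μ ^ 2 := by
      rw [Finset.mul_sum, ← hΩ, ← nsmul_eq_mul, ← Finset.card_univ, ← Finset.sum_const,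
        ← Finset.sum_sub_distrib, ← Finset.sum_add_distrib]
      exact Finset.sum_congr rfl fun ω _ => by ring
    have h2 : 2 * μ * (B.card * (H * T.card)) = 2 * (H * Q ^ 2 * μ ^ 2) := by
      rw [hμ]; field_simp
    have h3 : B.card * (T.card * (H * (B.card * (T.card / Q ^ 2) + 1 + V₀))) =
        H * Q ^ 2 * μ ^ 2 + B.card * (T.card * (H * (1 + V₀))) := by
      rw [hμ]; field_simp; ring
    rw [h1, hN1, h2]
    linarith
  have hmiss : ((Finset.univ.filter fun ω : (E →ₗ[F] W) × (W × W) =>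
      ∀ b ∈ B, (ω.1 (a₁ b) + ω.2.1, ω.1 (a₂ b) + ω.2.2) ∉ T).card : ℝ) * μ ^ 2 ≤
      ∑ ω, (N ω - μ) ^ 2 := by
    rw [← nsmul_eq_mul]
    refine (Finset.card_nsmul_le_sum _ (fun ω => (N ω - μ) ^ 2) _ fun ω hω => ?_).trans
      (Finset.sum_le_sum_of_subset_of_nonneg (Finset.subset_univ _) fun _ _ _ => sq_nonneg _)
    have : N ω = 0 := Finset.sum_eq_zero fun b hb => if_neg ((Finset.mem_filter.1 hω).2 b hb)
    simp [this]
  rw [← le_div_iff₀ (by positivity)] at hmiss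
  refine hmiss.trans ((div_le_div_of_nonneg_right hvar (by positivity)).trans (le_of_eq ?_))
  have hV' : ∑ c : F × F with IsDirection c, Q * MB c * MT c / (B.card * T.card) =
      Q ^ 2 / (B.card * T.card) * V₀ := by
    rw [hV, Finset.mul_sum]
    refine Finset.sum_congr rfl fun c _ => ?_
    field_simp
  rw [hΩ, hV', hμ]
  field_simp

end SecondMoment

/-! ### The random coding argument at a fixed length -/

section FixedLength

open scoped Classical

lemma le_card_typical {α : Type*} [Fintype α] {n : ℕ} {ε : ℝ} {p : α → ℝ}
    (hp : p ∈ stdSimplex ℝ α)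
    (h : 1 / 2 ≤ ∑ z : Fin n → α with IsTypical ε p z, wordProb p z) :
    Real.exp (n * ((1 - ε) * entropy p)) / 2 ≤
      ((Finset.univ.filter fun z : Fin n → α => IsTypical ε p z).card : ℝ) := by
  have h1 := Finset.sum_le_card_nsmul (Finset.univ.filter fun z : Fin n → α => IsTypical ε p z)
    (wordProb p) _ fun z hz => IsTypical.wordProb_le hp (Finset.mem_filter.1 hz).2
  rw [nsmul_eq_mul, Real.exp_neg] at h1
  have h2 := h.trans h1
  rw [← div_eq_mul_inv, le_div_iff₀ (Real.exp_pos _)] at h2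
  linarith

variable {𝒳 F : Type*} [Fintype 𝒳] [Field F] [Fintype F]

/-- The law of a pair of independent variables with laws `μ` and `ν`. -/
def prodLaw {α β : Type*} (μ : α → ℝ) (ν : β → ℝ) : α × β → ℝ := fun ab => μ ab.1 * ν ab.2

lemma prodLaw_mem_stdSimplex {α β : Type*} [Fintype α] [Fintype β] {μ : α → ℝ} {ν : β → ℝ}
    (hμ : μ ∈ stdSimplex ℝ α) (hν : ν ∈ stdSimplex ℝ β) : prodLaw μ ν ∈ stdSimplex ℝ (α × β) := by
  refine ⟨fun ab => mul_nonneg (hμ.1 _) (hν.1 _), ?_⟩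
  rw [Fintype.sum_prod_type]
  simp [prodLaw, ← Finset.mul_sum, hν.2, hμ.2]

lemma law_prodLaw_fst {α β : Type*} [Fintype α] [Fintype β] (μ : α → ℝ) {ν : β → ℝ}
    (hν : ν ∈ stdSimplex ℝ β) : law (prodLaw μ ν) Prod.fst = μ := by
  funext a
  rw [law, Finset.sum_filter, Fintype.sum_prod_type_right]
  simp [prodLaw, ← Finset.mul_sum, hν.2]

lemma law_prodLaw_snd {α β : Type*} [Fintype α] [Fintype β] {μ : α → ℝ} (ν : β → ℝ)
    (hμ : μ ∈ stdSimplex ℝ α) : law (prodLaw μ ν) Prod.snd = ν := by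
  funext b
  rw [law, Finset.sum_filter, Fintype.sum_prod_type]
  simp [prodLaw, ← Finset.sum_mul, hμ.2]

omit [Fintype F] in
/-- Every linear map from tuples of index words to words is given by generator matrices. -/
lemma exists_generator_matrices {m n : ℕ} {k : Fin m → ℕ}
    (L : ((i : Fin m) → Fin (k i) → F) →ₗ[F] (Fin n → F)) :
    ∃ G : (i : Fin m) → Matrix (Fin (k i)) (Fin n) F, ∀ u, L u = ∑ i, u i ᵥ* G i := by
  refine ⟨fun i => (LinearMap.toMatrix' (L ∘ₗ LinearMap.single F (fun i => Fin (k i) → F) i))ᵀ,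
    fun u => ?_⟩
  simp only [Matrix.vecMul_transpose, LinearMap.toMatrix'_mulVec]
  conv_lhs => rw [← Finset.univ_sum_single u, map_sum]
  rfl

/-- The exponent of the contribution to the variance of the index pairs that coincide. -/
noncomputable def diagExponent (P : 𝒳 × F × F → ℝ) {m : ℕ} (U₁ U₂ : Fin m → F → ℝ) (ε : ℝ) (κ : Fin m → ℝ)
    (ν : ℝ) : ℝ :=
  ν * (2 * Real.log (Fintype.card F)) -
    (∑ i, κ i * ((1 - ε) * entropy (prodLaw (U₁ i) (U₂ i))) +
      ν * ((1 - ε) * entropy P - (1 + ε) * entropy (law P Prod.fst)))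

/-- The law of `(X, s V₁ + t V₂)`, where `(s, t) = c`. -/
noncomputable def dirLaw (P : 𝒳 × F × F → ℝ) (c : F × F) : 𝒳 × F → ℝ :=
  law P fun z => (z.1, c.1 * z.2.1 + c.2 * z.2.2)

/-- The exponent of the contribution to the variance of the index pairs that collide in the
direction `c`. -/
noncomputable def dirExponent (P : 𝒳 × F × F → ℝ) {m : ℕ} (U₁ U₂ : Fin m → F → ℝ) (c : F × F) (ε : ℝ)
    (κ : Fin m → ℝ) (ν : ℝ) : ℝ :=
  ν * Real.log (Fintype.card F) +
    ∑ i, κ i * ((1 + ε) * entropy (prodLaw (U₁ i) (U₂ i)) -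
      (1 - ε) * entropy (combLaw c.1 c.2 (U₁ i) (U₂ i))) +
    ν * ((1 + ε) * entropy P - (1 - ε) * entropy (dirLaw P c)) -
    (∑ i, κ i * ((1 - ε) * entropy (prodLaw (U₁ i) (U₂ i))) +
      ν * ((1 - ε) * entropy P - (1 + ε) * entropy (law P Prod.fst)))

/-- The resulting bound on the probability that a given source word is not covered. The arguments
`κ` and `ν` stand for the dimensions and the length. -/
noncomputable def missBound (P : 𝒳 × F × F → ℝ) {m : ℕ} (U₁ U₂ : Fin m → F → ℝ) (ε : ℝ) (κ : Fin m → ℝ)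
    (ν : ℝ) : ℝ :=
  2 ^ (m + 1) * (Real.exp (diagExponent P U₁ U₂ ε κ ν) +
    ∑ c : F × F with IsDirection c, Real.exp (dirExponent P U₁ U₂ c ε κ ν))

variable {P : 𝒳 × F × F → ℝ} {m n : ℕ} {k : Fin m → ℕ} {U₁ U₂ : Fin m → F → ℝ} {ε : ℝ}

/-- A source word with enough jointly typical pairs is missed by few choices of generator matrices
and dithers. -/
lemma card_not_covered_le [Fintype (((i : Fin m) → Fin (k i) → F) →ₗ[F] (Fin n → F))]
    (hP : P ∈ stdSimplex ℝ (𝒳 × F × F))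
    (hU₁ : ∀ i, U₁ i ∈ stdSimplex ℝ F) (hU₂ : ∀ i, U₂ i ∈ stdSimplex ℝ F)
    (hk : ∀ i, 1 / 2 ≤ ∑ z : Fin (k i) → F × F with IsTypical ε (prodLaw (U₁ i) (U₂ i)) z,
      wordProb (prodLaw (U₁ i) (U₂ i)) z)
    (x : Fin n → 𝒳) (hx0 : 0 < wordProb (law P Prod.fst) x)
    (hx : wordProb (law P Prod.fst) x / 2 ≤
      ∑ z : Fin n → 𝒳 × F × F with IsTypical ε P z ∧ Prod.fst ∘ z = x, wordProb P z) :
    ((Finset.univ.filter fun ω : (((i : Fin m) → Fin (k i) → F) →ₗ[F] (Fin n → F)) ×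
        ((Fin n → F) × (Fin n → F)) =>
      ¬ ∃ u₁ u₂, (∀ i, IsTypical ε (U₁ i) (u₁ i)) ∧ (∀ i, IsTypical ε (U₂ i) (u₂ i)) ∧
        IsTypical ε P (fun j => (x j, (ω.1 u₁ + ω.2.1) j, (ω.1 u₂ + ω.2.2) j))).card : ℝ) ≤
    Fintype.card ((((i : Fin m) → Fin (k i) → F) →ₗ[F] (Fin n → F)) ×
        ((Fin n → F) × (Fin n → F))) * missBound P U₁ U₂ ε (fun i => k i) n := by
  set pr : Fin m → F × F → ℝ := fun i => prodLaw (U₁ i) (U₂ i) with hpr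
  have hprs : ∀ i, pr i ∈ stdSimplex ℝ (F × F) := fun i => prodLaw_mem_stdSimplex (hU₁ i) (hU₂ i)
  -- jointly typical pairs of index words, for which the number of collisions is controlled
  set B : Finset ((i : Fin m) → Fin (k i) → F × F) :=
    Fintype.piFinset fun i => Finset.univ.filter fun z => IsTypical ε (pr i) z with hB
  set a₁ : ((i : Fin m) → Fin (k i) → F × F) → (i : Fin m) → Fin (k i) → F :=
    fun z i r => (z i r).1 with ha₁
  set a₂ : ((i : Fin m) → Fin (k i) → F × F) → (i : Fin m) → Fin (k i) → F :=
    fun z i r => (z i r).2 with ha₂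
  set T : Finset ((Fin n → F) × (Fin n → F)) :=
    Finset.univ.filter fun v => IsTypical ε P (fun j => (x j, v.1 j, v.2 j)) with hT
  set eB : ℝ := ∑ i, (k i : ℝ) * ((1 - ε) * entropy (pr i)) with heB
  set eT : ℝ := n * ((1 - ε) * entropy P - (1 + ε) * entropy (law P Prod.fst)) with heT
  have hBlow : Real.exp eB / 2 ^ m ≤ B.card := by
    rw [hB, Fintype.card_piFinset, heB, Real.exp_sum]
    push_cast
    have : (2 : ℝ) ^ m = ∏ _i : Fin m, (2 : ℝ) := by simp
    rw [this, ← Finset.prod_div_distrib]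
    exact Finset.prod_le_prod (fun i _ => by positivity) fun i _ => le_card_typical (hprs i) (hk i)
  have hTlow : Real.exp eT / 2 ≤ T.card := by
    refine (le_card_typical_fiber hP Prod.fst x hx0 hx).trans ?_
    refine Nat.cast_le.2 (Finset.card_le_card_of_injOn
      (fun z => (fun j => (z j).2.1, fun j => (z j).2.2)) ?_ ?_)
    · intro z hz
      have hz := (Finset.mem_filter.1 (Finset.mem_coe.1 hz)).2
      simp only [hT, Finset.coe_filter, Finset.mem_univ, true_and, Set.mem_ofPred_eq, ← hz.2]
      exact hz.1
    · intro z hz z' hz' h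
      have hz := (Finset.mem_filter.1 (Finset.mem_coe.1 hz)).2.2
      have hz' := (Finset.mem_filter.1 (Finset.mem_coe.1 hz')).2.2
      funext j
      have h1 := congrFun (hz.trans hz'.symm) j
      have h2 := congrFun (congrArg Prod.fst h) j
      have h3 := congrFun (congrArg Prod.snd h) j
      exact Prod.ext h1 (Prod.ext h2 h3)
  have hBpos : (0 : ℝ) < B.card := lt_of_lt_of_le (by positivity) hBlow
  have hTpos : (0 : ℝ) < T.card := lt_of_lt_of_le (by positivity) hTlow
  set MB : F × F → ℝ := fun c => Real.exp (∑ i, (k i : ℝ) * ((1 + ε) * entropy (pr i) -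
    (1 - ε) * entropy (combLaw c.1 c.2 (U₁ i) (U₂ i)))) with hMBdef
  set MT : F × F → ℝ := fun c =>
    Real.exp (n * ((1 + ε) * entropy P - (1 - ε) * entropy (dirLaw P c))) with hMTdef
  have hMB : ∀ c : F × F, IsDirection c → ∀ e,
      ((B.filter fun b => c.1 • a₁ b + c.2 • a₂ b = e).card : ℝ) ≤ MB c := by
    intro c _ e
    have hsub : (B.filter fun b => c.1 • a₁ b + c.2 • a₂ b = e) ⊆
        Fintype.piFinset fun i => Finset.univ.filter fun z : Fin (k i) → F × F =>
          IsTypical ε (pr i) z ∧ (fun ab : F × F => c.1 * ab.1 + c.2 * ab.2) ∘ z = e i := by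
      intro z hz
      rw [Finset.mem_filter, hB, Fintype.mem_piFinset] at hz
      rw [Fintype.mem_piFinset]
      intro i
      have h1 := (Finset.mem_filter.1 (hz.1 i)).2
      refine Finset.mem_filter.2 ⟨Finset.mem_univ _, h1, ?_⟩
      rw [← hz.2]
      rfl
    refine (Nat.cast_le.2 (Finset.card_le_card hsub)).trans ?_
    rw [Fintype.card_piFinset]
    simp only [hMBdef, Real.exp_sum]
    push_cast
    refine Finset.prod_le_prod (fun i _ => Nat.cast_nonneg _) fun i _ => ?_
    exact card_typical_fiber_le (hprs i) _ (e i)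
  have hMT : ∀ c : F × F, IsDirection c → ∀ w,
      ((T.filter fun v => c.1 • v.1 + c.2 • v.2 = w).card : ℝ) ≤ MT c := by
    intro c _ w
    refine le_trans ?_ (card_typical_fiber_le (n := n) (ε := ε) hP
      (fun z => (z.1, c.1 * z.2.1 + c.2 * z.2.2)) (fun j => (x j, w j)))
    refine Nat.cast_le.2 (Finset.card_le_card_of_injOn
      (fun v j => (x j, v.1 j, v.2 j)) ?_ ?_)
    · intro v hv
      simp only [hT, Finset.filter_filter, Finset.coe_filter, Finset.mem_univ, true_and,
        Set.mem_ofPred_eq] at hv ⊢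
      refine ⟨hv.1, ?_⟩
      rw [← hv.2]
      rfl
    · intro v _ v' _ h
      refine Prod.ext (funext fun j => ?_) (funext fun j => ?_)
      · exact congrArg (fun t => t.2.1) (congrFun h j)
      · exact congrArg (fun t => t.2.2) (congrFun h j)
  have hmiss := card_miss_le (F := F) B a₁ a₂ (fun b b' h1 h2 => by
      funext i r
      exact Prod.ext (congrFun (congrFun h1 i) r) (congrFun (congrFun h2 i) r))
    T (Finset.card_pos.1 (Nat.cast_pos.1 hBpos)) (Finset.card_pos.1 (Nat.cast_pos.1 hTpos))
    MB MT (fun c hc e => by convert hMB c hc e) (fun c hc w => by convert hMT c hc w)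
  refine le_trans (Nat.cast_le.2 (Finset.card_le_card ?_)) (hmiss.trans
    (mul_le_mul_of_nonneg_left ?_ (Nat.cast_nonneg _)))
  · intro ω hω
    simp only [Finset.mem_filter, Finset.mem_univ, true_and] at hω ⊢
    intro b hb hbT
    refine hω ⟨a₁ b, a₂ b, fun i => ?_, fun i => ?_, (Finset.mem_filter.1 hbT).2⟩
    · have h1 := (Finset.mem_filter.1 (Fintype.mem_piFinset.1 hb i)).2.comp Prod.fst
      rwa [law_prodLaw_fst _ (hU₂ i)] at h1
    · have h1 := (Finset.mem_filter.1 (Fintype.mem_piFinset.1 hb i)).2.comp Prod.snd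
      rwa [law_prodLaw_snd _ (hU₁ i)] at h1
  · have hq : (0 : ℝ) < Fintype.card F := by exact_mod_cast Fintype.card_pos
    have hQ : ((Fintype.card (Fin n → F) : ℕ) : ℝ) =
        Real.exp (n * Real.log (Fintype.card F)) := by
      rw [Fintype.card_fun, Fintype.card_fin, Nat.cast_pow, Real.exp_nat_mul, Real.exp_log hq]
    have hinv : ((B.card : ℝ) * T.card)⁻¹ ≤ 2 ^ (m + 1) * Real.exp (-(eB + eT)) := by
      rw [Real.exp_neg, Real.exp_add, ← div_eq_mul_inv, ← inv_div]
      refine inv_anti₀ (by positivity) ?_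
      rw [pow_succ, ← div_mul_div_comm]
      exact mul_le_mul hBlow hTlow (by positivity) hBpos.le
    rw [missBound, mul_add, Finset.mul_sum]
    refine add_le_add ?_ (Finset.sum_le_sum fun c _ => ?_)
    · rw [div_eq_mul_inv]
      refine (mul_le_mul_of_nonneg_left hinv (by positivity)).trans (le_of_eq ?_)
      rw [hQ, mul_left_comm, ← Real.exp_nat_mul, ← Real.exp_add]
      congr 2
      simp only [diagExponent, heB, heT]
      push_cast
      ring
    · rw [div_eq_mul_inv]
      refine (mul_le_mul_of_nonneg_left hinv (by positivity)).trans (le_of_eq ?_)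
      rw [hQ, mul_left_comm, hMBdef, hMTdef, ← Real.exp_add, ← Real.exp_add, ← Real.exp_add]
      congr 2

/-- Averaging over the generator matrices and dithers. -/
lemma exists_coverProb_ge (hP : P ∈ stdSimplex ℝ (𝒳 × F × F))
    (hU₁ : ∀ i, U₁ i ∈ stdSimplex ℝ F) (hU₂ : ∀ i, U₂ i ∈ stdSimplex ℝ F)
    (hk : ∀ i, 1 / 2 ≤ ∑ z : Fin (k i) → F × F with IsTypical ε (prodLaw (U₁ i) (U₂ i)) z,
      wordProb (prodLaw (U₁ i) (U₂ i)) z) :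
    ∃ (G : (i : Fin m) → Matrix (Fin (k i)) (Fin n) F) (b₁ b₂ : Fin n → F),
      1 - 2 * (1 - ∑ z : Fin n → 𝒳 × F × F with IsTypical ε P z, wordProb P z) -
        missBound P U₁ U₂ ε (fun i => k i) n ≤
      coverProb P ε (qlc k ε U₁ G b₁) (qlc k ε U₂ G b₂) := by
  have : Finite (((i : Fin m) → Fin (k i) → F) →ₗ[F] (Fin n → F)) := DFunLike.finite _
  have := Fintype.ofFinite (((i : Fin m) → Fin (k i) → F) →ₗ[F] (Fin n → F))
  set pX := law P Prod.fst with hpX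
  have hpXs : pX ∈ stdSimplex ℝ 𝒳 := law_mem_stdSimplex hP _
  set Ω := (((i : Fin m) → Fin (k i) → F) →ₗ[F] (Fin n → F)) × ((Fin n → F) × (Fin n → F))
  set Cov : Ω → (Fin n → 𝒳) → Prop := fun ω x =>
    ∃ u₁ u₂, (∀ i, IsTypical ε (U₁ i) (u₁ i)) ∧ (∀ i, IsTypical ε (U₂ i) (u₂ i)) ∧
        IsTypical ε P (fun j => (x j, (ω.1 u₁ + ω.2.1) j, (ω.1 u₂ + ω.2.2) j)) with hCov
  set R := missBound P U₁ U₂ ε (fun i => (k i : ℝ)) n with hR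
  have hR0 : 0 ≤ R := by rw [hR, missBound]; positivity
  set τ := ∑ z : Fin n → 𝒳 × F × F with IsTypical ε P z, wordProb P z
  set good : (Fin n → 𝒳) → Prop := fun x => 0 < wordProb pX x ∧ wordProb pX x / 2 ≤
      ∑ z : Fin n → 𝒳 × F × F with IsTypical ε P z ∧ Prod.fst ∘ z = x, wordProb P z with hgood
  have hbad : ∑ x with ¬ good x, wordProb pX x ≤ 2 * (1 - τ) := sum_wordProb_bad_fiber_le hP _ ε n
  have hgoodsum : 1 - 2 * (1 - τ) ≤ ∑ x with good x, wordProb pX x := by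
    have := Finset.sum_filter_add_sum_filter_not Finset.univ good (wordProb pX)
    rw [sum_wordProb hpXs] at this
    linarith
  have hcount : ∀ x, good x →
      (Fintype.card Ω : ℝ) * (1 - R) ≤ (Finset.univ.filter fun ω : Ω => Cov ω x).card := by
    intro x hx
    have h1 : ((Finset.univ.filter fun ω : Ω => ¬ Cov ω x).card : ℝ) ≤ Fintype.card Ω * R :=
      card_not_covered_le hP hU₁ hU₂ hk x hx.1 hx.2
    have h2 := Finset.card_filter_add_card_filter_not (s := Finset.univ) (fun ω : Ω => Cov ω x)
    rw [Finset.card_univ] at h2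
    have h3 : ((Finset.univ.filter fun ω : Ω => Cov ω x).card : ℝ) +
      (Finset.univ.filter fun ω : Ω => ¬ Cov ω x).card = Fintype.card Ω := by exact_mod_cast h2
    linarith
  have hΩ : (0 : ℝ) < Fintype.card Ω := by exact_mod_cast Fintype.card_pos
  have havg : ∑ _ω : Ω, (1 - 2 * (1 - τ) - R) ≤ ∑ ω : Ω, ∑ x with Cov ω x, wordProb pX x := by
    have h1 : ∑ ω : Ω, ∑ x with Cov ω x, wordProb pX x =
        ∑ x, ((Finset.univ.filter fun ω : Ω => Cov ω x).card : ℝ) * wordProb pX x := by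
      simp only [Finset.sum_filter]
      rw [Finset.sum_comm]
      refine Finset.sum_congr rfl fun x _ => ?_
      rw [← Finset.sum_filter, Finset.sum_const, nsmul_eq_mul]
    rw [h1, Finset.sum_const, Finset.card_univ, nsmul_eq_mul]
    calc _ ≤ (Fintype.card Ω : ℝ) * (∑ x with good x, wordProb pX x - R) :=
          mul_le_mul_of_nonneg_left (by linarith) hΩ.le
      _ ≤ (Fintype.card Ω : ℝ) * ((1 - R) * ∑ x with good x, wordProb pX x) := by
          refine mul_le_mul_of_nonneg_left ?_ hΩ.le
          have : ∑ x with good x, wordProb pX x ≤ 1 := by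
            rw [← sum_wordProb (n := n) hpXs]
            exact Finset.sum_le_sum_of_subset_of_nonneg (Finset.subset_univ _)
              fun z _ _ => wordProb_nonneg hpXs.1 z
          nlinarith
      _ = ∑ x with good x, (Fintype.card Ω : ℝ) * (1 - R) * wordProb pX x := by
          rw [Finset.mul_sum, Finset.mul_sum]
          exact Finset.sum_congr rfl fun x _ => by ring
      _ ≤ ∑ x with good x,
            ((Finset.univ.filter fun ω : Ω => Cov ω x).card : ℝ) * wordProb pX x :=
          Finset.sum_le_sum fun x hx => mul_le_mul_of_nonneg_right
            (hcount x (Finset.mem_filter.1 hx).2) (wordProb_nonneg hpXs.1 x)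
      _ ≤ _ := Finset.sum_le_sum_of_subset_of_nonneg (Finset.subset_univ _)
            fun z _ _ => mul_nonneg (Nat.cast_nonneg _) (wordProb_nonneg hpXs.1 z)
  obtain ⟨ω, -, hω⟩ := Finset.exists_le_of_sum_le Finset.univ_nonempty havg
  obtain ⟨G, hG⟩ := exists_generator_matrices ω.1
  refine ⟨G, ω.2.1, ω.2.2, hω.trans ?_⟩
  refine Finset.sum_le_sum_of_subset_of_nonneg ?_ fun x _ _ => wordProb_nonneg hpXs.1 x
  intro x hx
  obtain ⟨u₁, u₂, h1, h2, h3⟩ := (Finset.mem_filter.1 hx).2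
  refine Finset.mem_filter.2 ⟨Finset.mem_univ _, _, ⟨u₁, h1, ?_⟩, _, ⟨u₂, h2, ?_⟩, h3⟩
  · rw [hG]
  · rw [hG]

end FixedLength

/-! ### Exponents -/

section Asymptotics

open scoped Classical

variable {𝒳 F : Type*} [Fintype 𝒳] [Field F] [Fintype F]
  {P : 𝒳 × F × F → ℝ} {m : ℕ} {U₁ U₂ : Fin m → F → ℝ}

lemma tendsto_exp_zero_of_tendsto_div {e : ℕ → ℝ} {ℓ : ℝ} (hℓ : ℓ < 0)
    (he : Tendsto (fun n : ℕ => e n / n) atTop (𝓝 ℓ)) :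
    Tendsto (fun n => Real.exp (e n)) atTop (𝓝 0) := by
  refine Real.tendsto_exp_atBot.comp ?_
  refine (Tendsto.atTop_mul_neg hℓ tendsto_natCast_atTop_atTop he).congr' ?_
  filter_upwards [eventually_gt_atTop 0] with n hn
  field_simp

omit [Field F] in
lemma diagExponent_div {ε : ℝ} (κ : Fin m → ℝ) {ν : ℝ} (hν : ν ≠ 0) :
    diagExponent P U₁ U₂ ε κ ν / ν = diagExponent P U₁ U₂ ε (fun i => κ i / ν) 1 := by
  have h : ∀ i x, κ i / ν * x * ν = κ i * x := fun i x => by field_simp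
  rw [div_eq_iff hν]
  simp only [diagExponent, sub_mul, add_mul, Finset.sum_mul, h]
  ring

lemma dirExponent_div {ε : ℝ} (c : F × F) (κ : Fin m → ℝ) {ν : ℝ} (hν : ν ≠ 0) :
    dirExponent P U₁ U₂ c ε κ ν / ν = dirExponent P U₁ U₂ c ε (fun i => κ i / ν) 1 := by
  have h : ∀ i x, κ i / ν * x * ν = κ i * x := fun i x => by field_simp
  rw [div_eq_iff hν]
  simp only [dirExponent, sub_mul, add_mul, Finset.sum_mul, h]
  ring

/-- If the exponents at `ε = 0` are negative for the limiting ratios `ρ`, then so are those for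
small `ε`, and the bound on the probability of a miss tends to `0`. -/
lemma exists_tendsto_missBound {ρ : Fin m → ℝ} (hdiag : diagExponent P U₁ U₂ 0 ρ 1 < 0)
    (hdir : ∀ c, IsDirection c → dirExponent P U₁ U₂ c 0 ρ 1 < 0) {η : ℝ} (hη : 0 < η) :
    ∃ ε, 0 < ε ∧ ε ≤ η ∧ ∀ k : ℕ → Fin m → ℕ,
      (∀ i, Tendsto (fun n => (k n i : ℝ) / n) atTop (𝓝 (ρ i))) →
      Tendsto (fun n : ℕ => missBound P U₁ U₂ ε (fun i => k n i) n) atTop (𝓝 0) := by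
  have h1 : ∀ᶠ ε in 𝓝 (0 : ℝ), diagExponent P U₁ U₂ ε ρ 1 < 0 := by
    have : Continuous fun ε => diagExponent P U₁ U₂ ε ρ 1 := by
      unfold diagExponent; fun_prop
    exact this.continuousAt.eventually_lt continuousAt_const hdiag
  have h2 : ∀ᶠ ε in 𝓝 (0 : ℝ), ∀ c, IsDirection c → dirExponent P U₁ U₂ c ε ρ 1 < 0 := by
    rw [eventually_all]
    intro c
    by_cases hc : IsDirection c
    · have : Continuous fun ε => dirExponent P U₁ U₂ c ε ρ 1 := by
        unfold dirExponent; fun_prop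
      filter_upwards [this.continuousAt.eventually_lt continuousAt_const (hdir c hc)] with ε h _
      exact h
    · exact Eventually.of_forall fun _ h => absurd h hc
  have h3 : ∀ᶠ ε in 𝓝[>] (0 : ℝ), ε ∈ Set.Ioc 0 η := Ioc_mem_nhdsGT hη
  obtain ⟨ε, ⟨hε1, hε2⟩, hε3⟩ := ((h1.and h2).filter_mono nhdsWithin_le_nhds |>.and h3).exists
  refine ⟨ε, hε3.1, hε3.2, fun k hk => ?_⟩
  have hA : Tendsto (fun n : ℕ => Real.exp (diagExponent P U₁ U₂ ε (fun i => (k n i : ℝ)) n)) atTop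
      (𝓝 0) := by
    refine tendsto_exp_zero_of_tendsto_div hε1 ?_
    have : Tendsto (fun n : ℕ => diagExponent P U₁ U₂ ε (fun i => (k n i : ℝ) / n) 1) atTop
        (𝓝 (diagExponent P U₁ U₂ ε ρ 1)) := by
      unfold diagExponent
      exact ((tendsto_finsetSum _ fun i _ => (hk i).mul_const _).add_const _).const_sub _
    refine this.congr' ?_
    filter_upwards [eventually_ne_atTop 0] with n hn
    rw [diagExponent_div _ (by exact_mod_cast hn)]
  have hB : ∀ c, IsDirection c →
      Tendsto (fun n : ℕ => Real.exp (dirExponent P U₁ U₂ c ε (fun i => (k n i : ℝ)) n)) atTop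
        (𝓝 0) := by
    intro c hc
    refine tendsto_exp_zero_of_tendsto_div (hε2 c hc) ?_
    have : Tendsto (fun n : ℕ => dirExponent P U₁ U₂ c ε (fun i => (k n i : ℝ) / n) 1) atTop
        (𝓝 (dirExponent P U₁ U₂ c ε ρ 1)) := by
      unfold dirExponent
      exact (((tendsto_finsetSum _ fun i _ => (hk i).mul_const _).const_add _).add_const _).sub
        ((tendsto_finsetSum _ fun i _ => (hk i).mul_const _).add_const _)
    refine this.congr' ?_
    filter_upwards [eventually_ne_atTop 0] with n hn
    rw [dirExponent_div _ _ (by exact_mod_cast hn)]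
  unfold missBound
  have := (hA.add (tendsto_finsetSum (Finset.univ.filter fun c : F × F => IsDirection c)
    fun c hc => hB c (Finset.mem_filter.1 hc).2)).const_mul (2 ^ (m + 1))
  simpa using this

omit [Fintype F] in
lemma qlc_mono {n : ℕ} {k : Fin m → ℕ} {ε η : ℝ} (h : ε ≤ η) (hU : ∀ i a, 0 ≤ U₁ i a)
    (G : (i : Fin m) → Matrix (Fin (k i)) (Fin n) F) (b : Fin n → F) :
    qlc k ε U₁ G b ⊆ qlc k η U₁ G b := by
  rintro c ⟨u, hu, hc⟩
  exact ⟨u, fun i => (hu i).mono (hU i) h, hc⟩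

omit [Field F] in
lemma coverProb_mono {n : ℕ} (hP : P ∈ stdSimplex ℝ (𝒳 × F × F)) {ε η : ℝ} (h : ε ≤ η)
    {C₁ C₂ D₁ D₂ : Set (Fin n → F)} (h₁ : C₁ ⊆ D₁) (h₂ : C₂ ⊆ D₂) :
    coverProb P ε C₁ C₂ ≤ coverProb P η D₁ D₂ := by
  refine Finset.sum_le_sum_of_subset_of_nonneg ?_
    fun x _ _ => wordProb_nonneg (law_mem_stdSimplex hP _).1 x
  intro x hx
  obtain ⟨v₁, hv₁, v₂, hv₂, hv⟩ := (Finset.mem_filter.1 hx).2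
  exact Finset.mem_filter.2
    ⟨Finset.mem_univ _, v₁, h₁ hv₁, v₂, h₂ hv₂, hv.mono hP.1 h⟩

/-- The covering lemma: if all exponents are negative, then codes of parameter `η` that miss at
most a probability `η` of the source words exist at every large length. -/
lemma eventually_exists_coverProb_ge (hP : P ∈ stdSimplex ℝ (𝒳 × F × F))
    (hU₁ : ∀ i, U₁ i ∈ stdSimplex ℝ F) (hU₂ : ∀ i, U₂ i ∈ stdSimplex ℝ F)
    {ρ : Fin m → ℝ} (hρ : ∀ i, 0 < ρ i) (hdiag : diagExponent P U₁ U₂ 0 ρ 1 < 0)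
    (hdir : ∀ c, IsDirection c → dirExponent P U₁ U₂ c 0 ρ 1 < 0) {k : ℕ → Fin m → ℕ}
    (hk : ∀ i, Tendsto (fun n => (k n i : ℝ) / n) atTop (𝓝 (ρ i))) {η : ℝ} (hη : 0 < η) :
    ∀ᶠ n : ℕ in atTop, ∃ (G : (i : Fin m) → Matrix (Fin (k n i)) (Fin n) F) (b₁ b₂ : Fin n → F),
      1 - η ≤ coverProb P η (qlc (k n) η U₁ G b₁) (qlc (k n) η U₂ G b₂) := by
  obtain ⟨ε, hε, hεη, hmiss⟩ := exists_tendsto_missBound hdiag hdir hη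
  have hmiss := hmiss k hk
  have hkinf : ∀ i, Tendsto (fun n => k n i) atTop atTop := by
    intro i
    refine tendsto_natCast_atTop_iff (R := ℝ).1 ?_
    refine (Tendsto.pos_mul_atTop (hρ i) (hk i) tendsto_natCast_atTop_atTop).congr' ?_
    filter_upwards [eventually_ne_atTop 0] with n hn
    field_simp
  have hhalf : ∀ᶠ n in atTop, ∀ i, 1 / 2 ≤
      ∑ z : Fin (k n i) → F × F with IsTypical ε (prodLaw (U₁ i) (U₂ i)) z,
        wordProb (prodLaw (U₁ i) (U₂ i)) z := by
    rw [eventually_all]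
    intro i
    have := (tendsto_sum_wordProb_typical (prodLaw_mem_stdSimplex (hU₁ i) (hU₂ i)) hε).comp
      (hkinf i)
    exact (this.eventually_const_lt (by norm_num : (1 / 2 : ℝ) < 1)).mono fun n h => h.le
  have hlim := (((tendsto_sum_wordProb_typical hP hε).const_sub 1).const_mul 2).add hmiss
  simp only [sub_self, mul_zero, add_zero] at hlim
  filter_upwards [hhalf, hlim.eventually_lt_const hη] with n h1 h2
  obtain ⟨G, b₁, b₂, h⟩ := exists_coverProb_ge (n := n) hP hU₁ hU₂ h1
  refine ⟨G, b₁, b₂, ?_⟩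
  refine le_trans ?_ (h.trans (coverProb_mono hP hεη (qlc_mono hεη (fun i => (hU₁ i).1) G b₁)
    (qlc_mono hεη (fun i => (hU₂ i).1) G b₂)))
  linarith

end Asymptotics

/-! ### Entropy -/

section Entropy

open scoped Classical

variable {α β γ : Type*} [Fintype α] [Fintype β] [Fintype γ]

omit [Fintype γ] in
lemma law_law (p : α → ℝ) (f : α → β) (g : β → γ) : law (law p f) g = law p (g ∘ f) := by
  funext c
  simp only [law]
  rw [← Finset.sum_fiberwise_of_maps_to (g := f)
    (t := Finset.univ.filter fun b => g b = c) (by simp)]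
  refine Finset.sum_congr rfl fun b hb => Finset.sum_congr ?_ fun _ _ => rfl
  have hb := (Finset.mem_filter.1 hb).2
  ext a
  simp only [Finset.mem_filter, Finset.mem_univ, true_and, Function.comp]
  exact ⟨fun h => ⟨h ▸ hb, h⟩, fun h => h.2⟩

lemma law_id (p : α → ℝ) : law p id = p := by
  funext a
  rw [law, Finset.sum_filter]
  simp

omit [Fintype β] in
lemma law_equiv (p : α → ℝ) (e : α ≃ β) : law p e = p ∘ e.symm := by
  funext b
  have : (Finset.univ.filter fun a => e a = b) = {e.symm b} := by
    ext a
    simp [Equiv.eq_symm_apply]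
  simp [law, this]

lemma entropy_law_equiv (p : α → ℝ) (e : α ≃ β) : entropy (law p e) = entropy p := by
  rw [law_equiv, entropy, entropy]
  exact e.symm.sum_comp fun a => Real.negMulLog (p a)

lemma entropy_prodLaw {μ : α → ℝ} {ν : β → ℝ} (hμ : μ ∈ stdSimplex ℝ α)
    (hν : ν ∈ stdSimplex ℝ β) : entropy (prodLaw μ ν) = entropy μ + entropy ν := by
  simp only [entropy, prodLaw, Fintype.sum_prod_type, Real.negMulLog_mul, Finset.sum_add_distrib,
    ← Finset.sum_mul, ← Finset.mul_sum, hν.2, hμ.2, one_mul]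

lemma law_fst_apply (p : α × β → ℝ) (x : α) : law p Prod.fst x = ∑ y, p (x, y) := by
  rw [law, Finset.sum_filter, Fintype.sum_prod_type_right]
  simp

/-- The chain rule `H(Y | X) = H(X, Y) - H(X)`. -/
lemma condEntropy_eq {p : α × β → ℝ} (hp : p ∈ stdSimplex ℝ (α × β)) :
    condEntropy p = entropy p - entropy (law p Prod.fst) := by
  rw [condEntropy, entropy, entropy, Fintype.sum_prod_type, ← Finset.sum_sub_distrib]
  refine Finset.sum_congr rfl fun x _ => ?_
  rcases ((law_mem_stdSimplex hp Prod.fst).1 x).eq_or_lt with h | h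
  · have h0 : ∀ y, p (x, y) = 0 := fun y =>
      le_antisymm ((le_law hp.1 Prod.fst (x, y)).trans h.ge) (hp.1 _)
    simp [← h, h0]
  · have h1 : ∀ y, Real.negMulLog (p (x, y)) =
        p (x, y) / law p Prod.fst x * Real.negMulLog (law p Prod.fst x) +
          law p Prod.fst x * Real.negMulLog (p (x, y) / law p Prod.fst x) := by
      intro y
      rw [← Real.negMulLog_mul, mul_div_cancel₀ _ h.ne']
    have h2 : ∑ y, p (x, y) / law p Prod.fst x = 1 := by
      rw [← Finset.sum_div, ← law_fst_apply, div_self h.ne']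
    rw [Finset.sum_congr rfl fun y _ => h1 y, Finset.sum_add_distrib, ← Finset.sum_mul, h2,
      ← Finset.mul_sum, entropy]
    ring

/-- The uniform mass function. -/
noncomputable def unif (α : Type*) [Fintype α] : α → ℝ := fun _ => (Fintype.card α : ℝ)⁻¹

lemma unif_mem_stdSimplex [Nonempty α] : unif α ∈ stdSimplex ℝ α :=
  ⟨fun _ => by unfold unif; positivity, by simp [unif]⟩

lemma entropy_unif [Nonempty α] : entropy (unif α) = Real.log (Fintype.card α) := by
  simp [entropy, unif, Real.negMulLog]

lemma entropy_le_log_card [Nonempty α] {p : α → ℝ} (hp : p ∈ stdSimplex ℝ α) :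
    entropy p ≤ Real.log (Fintype.card α) ∧
      (Real.log (Fintype.card α) ≤ entropy p → p = unif α) := by
  have hc : (0 : ℝ) < Fintype.card α := by exact_mod_cast Fintype.card_pos
  have hw : ∑ _a : α, (Fintype.card α : ℝ)⁻¹ = 1 := by simp
  have hcent : Real.negMulLog (∑ a, (Fintype.card α : ℝ)⁻¹ • p a) =
      (Fintype.card α : ℝ)⁻¹ * Real.log (Fintype.card α) := by
    rw [← Finset.smul_sum, hp.2, smul_eq_mul, mul_one, Real.negMulLog, Real.log_inv]
    ring
  have hent : ∑ a, (Fintype.card α : ℝ)⁻¹ • Real.negMulLog (p a) =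
      (Fintype.card α : ℝ)⁻¹ * entropy p := by
    rw [← Finset.smul_sum, smul_eq_mul, entropy]
  constructor
  · have := Real.concaveOn_negMulLog.le_map_sum (t := Finset.univ)
      (w := fun _ : α => (Fintype.card α : ℝ)⁻¹) (p := p) (fun _ _ => by positivity) hw
      (fun a _ => hp.1 a)
    rw [hcent, hent] at this
    exact le_of_mul_le_mul_left this (by positivity)
  · intro h
    have heq := Real.strictConcaveOn_negMulLog.eq_of_map_sum_eq (t := Finset.univ)
      (w := fun _ : α => (Fintype.card α : ℝ)⁻¹) (p := p) (fun _ _ => by positivity) hw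
      (fun a _ => hp.1 a) (by
        rw [hcent, hent]; exact mul_le_mul_of_nonneg_left h (by positivity))
    funext a
    have h1 := hp.2
    rw [Finset.sum_congr rfl fun b hb => heq hb (Finset.mem_univ a)] at h1
    rw [Finset.sum_const, Finset.card_univ, nsmul_eq_mul] at h1
    exact eq_inv_of_mul_eq_one_right h1

lemma cond_mem_stdSimplex {p : α × β → ℝ} (hp : p ∈ stdSimplex ℝ (α × β)) {x : α}
    (h : 0 < law p Prod.fst x) : (fun y => p (x, y) / law p Prod.fst x) ∈ stdSimplex ℝ β :=
  ⟨fun y => div_nonneg (hp.1 _) h.le, by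
    rw [← Finset.sum_div, ← law_fst_apply, div_self h.ne']⟩

/-- Conditional entropy is at most `log |β|`, with equality only for `Y` uniform and independent
of `X`. -/
lemma condEntropy_le_log_card [Nonempty β] {p : α × β → ℝ} (hp : p ∈ stdSimplex ℝ (α × β)) :
    condEntropy p ≤ Real.log (Fintype.card β) ∧
      (Real.log (Fintype.card β) ≤ condEntropy p → p = prodLaw (law p Prod.fst) (unif β)) := by
  have hX := law_mem_stdSimplex hp Prod.fst
  have hterm : ∀ x, law p Prod.fst x * entropy (fun y => p (x, y) / law p Prod.fst x) ≤
      law p Prod.fst x * Real.log (Fintype.card β) := by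
    intro x
    rcases (hX.1 x).eq_or_lt with h | h
    · simp [← h]
    · exact mul_le_mul_of_nonneg_left (entropy_le_log_card (cond_mem_stdSimplex hp h)).1 h.le
  have hsum : ∑ x, law p Prod.fst x * Real.log (Fintype.card β) = Real.log (Fintype.card β) := by
    rw [← Finset.sum_mul, hX.2, one_mul]
  constructor
  · rw [← hsum]
    exact Finset.sum_le_sum fun x _ => hterm x
  · intro hle
    have heq := (Finset.sum_eq_sum_iff_of_le fun x (_ : x ∈ Finset.univ) => hterm x).1
      (le_antisymm (Finset.sum_le_sum fun x _ => hterm x) (by rw [hsum]; exact hle))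
    funext ⟨x, y⟩
    rcases (hX.1 x).eq_or_lt with h | h
    · rw [prodLaw, ← h, zero_mul]
      exact le_antisymm ((le_law hp.1 Prod.fst (x, y)).trans h.ge) (hp.1 _)
    · have h1 := (entropy_le_log_card (cond_mem_stdSimplex hp h)).2
        (mul_left_cancel₀ h.ne' (heq x (Finset.mem_univ x))).ge
      have h2 := congrFun h1 y
      simp only [div_eq_iff h.ne'] at h2
      rw [h2, prodLaw, mul_comm]

/-- Only point masses have entropy zero. -/
lemma exists_eq_one_of_entropy_eq_zero {p : α → ℝ} (hp : p ∈ stdSimplex ℝ α)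
    (h : entropy p = 0) : ∃ a, p a = 1 := by
  have h0 := (Finset.sum_eq_zero_iff_of_nonneg fun a _ =>
    Real.negMulLog_nonneg (hp.1 a) (le_one_of_mem_stdSimplex hp a)).1 h
  obtain ⟨a, ha⟩ : ∃ a, p a ≠ 0 := by
    by_contra! hne
    have := hp.2
    simp [hne] at this
  refine ⟨a, ?_⟩
  have h1 := h0 a (Finset.mem_univ a)
  rw [Real.negMulLog, mul_eq_zero, neg_eq_zero] at h1
  have h2 := h1.resolve_left ha
  rw [Real.log_eq_zero] at h2
  have := hp.1 a
  rcases h2 with h2 | h2 | h2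
  · exact absurd h2 ha
  · exact h2
  · linarith

lemma eq_zero_of_eq_one {p : α → ℝ} (hp : p ∈ stdSimplex ℝ α) {a b : α} (ha : p a = 1)
    (hb : b ≠ a) : p b = 0 := by
  have h1 := hp.2
  rw [← Finset.add_sum_erase _ _ (Finset.mem_univ a), ha, add_eq_left] at h1
  exact (Finset.sum_eq_zero_iff_of_nonneg fun c _ => hp.1 c).1 h1 b (by simp [hb])

lemma entropy_eq_zero_of_eq_one {p : α → ℝ} (hp : p ∈ stdSimplex ℝ α) {a : α} (ha : p a = 1) :
    entropy p = 0 := by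
  refine Finset.sum_eq_zero fun b _ => ?_
  by_cases hb : b = a
  · rw [hb, ha, Real.negMulLog_one]
  · rw [eq_zero_of_eq_one hp ha hb, Real.negMulLog_zero]

end Entropy

section Combination

open scoped Classical

variable {F : Type*} [Field F] [Fintype F] {μ ν : F → ℝ}

lemma combLaw_mem_stdSimplex (hμ : μ ∈ stdSimplex ℝ F) (hν : ν ∈ stdSimplex ℝ F) (s t : F) :
    combLaw s t μ ν ∈ stdSimplex ℝ F :=
  law_mem_stdSimplex (prodLaw_mem_stdSimplex hμ hν) _

lemma combLaw_one_zero (hν : ν ∈ stdSimplex ℝ F) : combLaw 1 0 μ ν = μ := by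
  rw [← law_prodLaw_fst μ hν]
  simp only [combLaw, one_mul, zero_mul, add_zero, law_prodLaw_fst μ hν]
  exact law_prodLaw_fst μ hν

lemma combLaw_zero_one (hμ : μ ∈ stdSimplex ℝ F) : combLaw 0 1 μ ν = ν := by
  simp only [combLaw, one_mul, zero_mul, zero_add]
  exact law_prodLaw_snd ν hμ

/-- A combination `s A + t B` with `s ≠ 0` is deterministic only if `A` is. -/
lemma entropy_combLaw_pos (hμ : μ ∈ stdSimplex ℝ F) (hν : ν ∈ stdSimplex ℝ F) {s t : F}
    (hs : s ≠ 0) (h : 0 < entropy μ) : 0 < entropy (combLaw s t μ ν) := by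
  have hc := combLaw_mem_stdSimplex hμ hν s t
  refine (entropy_nonneg hc).lt_of_ne fun h0 => ?_
  obtain ⟨w, hw⟩ := exists_eq_one_of_entropy_eq_zero hc h0.symm
  obtain ⟨b, hb⟩ : ∃ b, ν b ≠ 0 := by
    by_contra! hne
    have := hν.2
    simp [hne] at this
  have key : ∀ a, μ a ≠ 0 → s * a + t * b = w := by
    intro a ha
    by_contra hne
    have h1 := eq_zero_of_eq_one hc hw hne
    have h2 := le_law (prodLaw_mem_stdSimplex hμ hν).1
      (fun ab : F × F => s * ab.1 + t * ab.2) (a, b)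
    have h3 : 0 < μ a * ν b := mul_pos ((hμ.1 a).lt_of_ne' ha) ((hν.1 b).lt_of_ne' hb)
    exact absurd (h3.trans_le (h2.trans_eq h1)) (lt_irrefl _)
  have hμ1 : μ ((w - t * b) / s) = 1 := by
    rw [← hμ.2]
    refine (Finset.sum_eq_single_of_mem _ (Finset.mem_univ _) fun a _ ha => ?_).symm
    by_contra h1
    refine ha ?_
    rw [← key a h1, eq_div_iff hs]
    ring
  exact h.ne' (entropy_eq_zero_of_eq_one hμ hμ1)

variable {𝒳 : Type*} [Fintype 𝒳] {P : 𝒳 × F × F → ℝ} {m : ℕ} {U₁ U₂ : Fin m → F → ℝ}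

omit [Field F] in
lemma diagExponent_zero (hP : P ∈ stdSimplex ℝ (𝒳 × F × F))
    (hU₁ : ∀ i, U₁ i ∈ stdSimplex ℝ F) (hU₂ : ∀ i, U₂ i ∈ stdSimplex ℝ F) (ρ : Fin m → ℝ) :
    diagExponent P U₁ U₂ 0 ρ 1 = 2 * Real.log (Fintype.card F) - condEntropy P -
      ∑ i, ρ i * (entropy (U₁ i) + entropy (U₂ i)) := by
  simp only [diagExponent, entropy_prodLaw (hU₁ _) (hU₂ _), condEntropy_eq hP]
  ring_nf

lemma dirExponent_zero (hP : P ∈ stdSimplex ℝ (𝒳 × F × F)) (ρ : Fin m → ℝ) (c : F × F) :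
    dirExponent P U₁ U₂ c 0 ρ 1 = Real.log (Fintype.card F) - condEntropy (dirLaw P c) -
      ∑ i, ρ i * entropy (combLaw c.1 c.2 (U₁ i) (U₂ i)) := by
  have h : law (dirLaw P c) Prod.fst = law P Prod.fst := law_law _ _ _
  have hd : dirLaw P c ∈ stdSimplex ℝ (𝒳 × F) := law_mem_stdSimplex hP _
  rw [condEntropy_eq hd, h]
  simp only [dirExponent, sub_zero, add_zero, one_mul, mul_sub, Finset.sum_sub_distrib]
  ring

lemma dirLaw_one_zero : dirLaw P (1, 0) = law P fun z => (z.1, z.2.1) := by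
  simp [dirLaw]

lemma dirLaw_zero_one : dirLaw P (0, 1) = law P fun z => (z.1, z.2.2) := by
  simp [dirLaw]

/-- The covering lemma in terms of conditional entropies. -/
lemma eventually_exists_coverProb_ge_of_lt (hP : P ∈ stdSimplex ℝ (𝒳 × F × F))
    (hU₁ : ∀ i, U₁ i ∈ stdSimplex ℝ F) (hU₂ : ∀ i, U₂ i ∈ stdSimplex ℝ F)
    {ρ : Fin m → ℝ} (hρ : ∀ i, 0 < ρ i)
    (h₁ : Real.log (Fintype.card F) - condEntropy (law P fun z => (z.1, z.2.1)) <
      ∑ i, ρ i * entropy (U₁ i))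
    (h₂ : Real.log (Fintype.card F) - condEntropy (law P fun z => (z.1, z.2.2)) <
      ∑ i, ρ i * entropy (U₂ i))
    (h₁₂ : 2 * Real.log (Fintype.card F) - condEntropy P <
      ∑ i, ρ i * (entropy (U₁ i) + entropy (U₂ i)))
    (hst : ∀ s t : F, s ≠ 0 → t ≠ 0 → Real.log (Fintype.card F) -
        condEntropy (law P fun z => (z.1, s * z.2.1 + t * z.2.2)) <
      ∑ i, ρ i * entropy (combLaw s t (U₁ i) (U₂ i)))
    {k : ℕ → Fin m → ℕ} (hk : ∀ i, Tendsto (fun n => (k n i : ℝ) / n) atTop (𝓝 (ρ i)))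
    {η : ℝ} (hη : 0 < η) :
    ∀ᶠ n : ℕ in atTop, ∃ (G : (i : Fin m) → Matrix (Fin (k n i)) (Fin n) F) (b₁ b₂ : Fin n → F),
      1 - η ≤ coverProb P η (qlc (k n) η U₁ G b₁) (qlc (k n) η U₂ G b₂) := by
  refine eventually_exists_coverProb_ge hP hU₁ hU₂ hρ ?_ ?_ hk hη
  · rw [diagExponent_zero hP hU₁ hU₂]
    linarith
  · rintro c hc
    rw [dirExponent_zero hP]
    rcases hc with rfl | rfl | hc
    · simp only [dirLaw_one_zero, combLaw_one_zero (hU₂ _)]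
      linarith
    · simp only [dirLaw_zero_one, combLaw_zero_one (hU₁ _)]
      linarith
    · have := hst c.1 c.2 hc.1 hc.2
      rw [dirLaw]
      linarith

end Combination

/-! ### Deterministic index variables -/

section Degenerate

open scoped Classical

variable {𝒳 F : Type*} [Fintype 𝒳] [Field F] [Fintype F]

/-- Some realization of an independent component does at least as well as the average. -/
lemma exists_sum_wordProb_ge {β : Type*} [Fintype β] {n : ℕ} {μ : 𝒳 → ℝ} {ν : β → ℝ}
    (hν : ν ∈ stdSimplex ℝ β) (S : (Fin n → 𝒳 × β) → Prop) :
    ∃ w : Fin n → β, ∑ z with S z, wordProb (prodLaw μ ν) z ≤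
      ∑ x : Fin n → 𝒳 with S (fun j => (x j, w j)), wordProb μ x := by
  by_contra! h
  have h1 : ∑ z with S z, wordProb (prodLaw μ ν) z =
      ∑ w : Fin n → β, wordProb ν w *
        ∑ x : Fin n → 𝒳 with S (fun j => (x j, w j)), wordProb μ x := by
    rw [Finset.sum_filter, ← (Equiv.arrowProdEquivProdArrow (Fin n) (fun _ => 𝒳)
      (fun _ => β)).symm.sum_comp, Fintype.sum_prod_type_right]
    refine Finset.sum_congr rfl fun w _ => ?_
    rw [Finset.sum_filter, Finset.mul_sum]
    refine Finset.sum_congr rfl fun x _ => ?_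
    simp only [Equiv.arrowProdEquivProdArrow_symm_apply, wordProb, prodLaw, mul_ite, mul_zero,
      Finset.prod_mul_distrib]
    rw [mul_comm]
    rfl
  set A := ∑ z with S z, wordProb (prodLaw μ ν) z with hA
  have h2 : ∑ w : Fin n → β, wordProb ν w *
        ∑ x : Fin n → 𝒳 with S (fun j => (x j, w j)), wordProb μ x <
      ∑ w : Fin n → β, wordProb ν w * A := by
    obtain ⟨w, hw⟩ : ∃ w : Fin n → β, wordProb ν w ≠ 0 := by
      by_contra! h0
      have := sum_wordProb (n := n) hν
      simp [h0] at this
    refine Finset.sum_lt_sum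
      (fun w _ => mul_le_mul_of_nonneg_left (h w).le (wordProb_nonneg hν.1 w))
      ⟨w, Finset.mem_univ w, ?_⟩
    exact mul_lt_mul_of_pos_left (h w) ((wordProb_nonneg hν.1 w).lt_of_ne' hw)
  rw [← h1, ← Finset.sum_mul, sum_wordProb hν, one_mul] at h2
  exact lt_irrefl _ h2

/-- A constant word is typical for a point mass, and translating the code moves it anywhere. -/
lemma exists_mem_qlc {m n : ℕ} {k : Fin m → ℕ} {η : ℝ} (hη : 0 ≤ η) {U : Fin m → F → ℝ}
    (hU : ∀ i, U i ∈ stdSimplex ℝ F) (h0 : ∀ i, entropy (U i) = 0)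
    (G : (i : Fin m) → Matrix (Fin (k i)) (Fin n) F) (w : Fin n → F) :
    ∃ b, w ∈ qlc k η U G b := by
  choose a ha using fun i => exists_eq_one_of_entropy_eq_zero (hU i) (h0 i)
  refine ⟨w - ∑ i, (fun _ => a i) ᵥ* G i, fun i _ => a i, fun i c => ?_, by simp⟩
  have hnn : 0 ≤ η * (k i * U i c) :=
    mul_nonneg hη (mul_nonneg (Nat.cast_nonneg _) ((hU i).1 c))
  refine le_trans (le_of_eq ?_) hnn
  by_cases hc : c = a i
  · simp [hc, ha, occ]
  · rw [eq_zero_of_eq_one (hU i) (ha i) hc]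
    simp [occ, Ne.symm hc]

/-- Adding a nonzero multiple of an independent uniform variable gives an independent uniform
variable. -/
lemma law_add_unif {α β : Type*} [Fintype α] [Fintype β] (p : α → ℝ) (g : α → β) (h : α → F)
    {s : F} (hs : s ≠ 0) :
    law (prodLaw (unif F) p) (fun z => (g z.2, s * z.1 + h z.2)) =
      prodLaw (law p g) (unif F) := by
  funext ⟨y, w⟩
  rw [law, Finset.sum_filter, Fintype.sum_prod_type_right, prodLaw, law, Finset.sum_filter,
    Finset.sum_mul]
  refine Finset.sum_congr rfl fun a _ => ?_
  have h1 : ∀ v : F, (g a, s * v + h a) = (y, w) ↔ g a = y ∧ v = (w - h a) / s := by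
    intro v
    rw [Prod.mk.injEq, eq_div_iff hs, eq_sub_iff_add_eq, mul_comm]
  simp only [h1, prodLaw, unif, ite_and]
  split_ifs <;> simp [mul_comm]

/-- Covering by a single quasi-linear code. It follows from the covering by pairs, with a second
target that is uniform and independent of everything, and uniform index variables for it. -/
lemma eventually_exists_single_cover {𝒴 : Type*} [Fintype 𝒴] {R : 𝒴 × F → ℝ}
    (hR : R ∈ stdSimplex ℝ (𝒴 × F)) {m : ℕ} [NeZero m] {U : Fin m → F → ℝ}
    (hU : ∀ i, U i ∈ stdSimplex ℝ F) {ρ : Fin m → ℝ} (hρ : ∀ i, 0 < ρ i)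
    (h : Real.log (Fintype.card F) - condEntropy R < ∑ i, ρ i * entropy (U i))
    {k : ℕ → Fin m → ℕ} (hk : ∀ i, Tendsto (fun n => (k n i : ℝ) / n) atTop (𝓝 (ρ i)))
    {η : ℝ} (hη : 0 < η) :
    ∀ᶠ n : ℕ in atTop, ∃ (G : (i : Fin m) → Matrix (Fin (k n i)) (Fin n) F) (b : Fin n → F),
      1 - η ≤ ∑ y : Fin n → 𝒴 with ∃ v ∈ qlc (k n) η U G b, IsTypical η R (fun j => (y j, v j)),
        wordProb (law R Prod.fst) y := by
  have hu : unif F ∈ stdSimplex ℝ F := unif_mem_stdSimplex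
  have hQ := prodLaw_mem_stdSimplex hu hR
  let e : F × 𝒴 × F ≃ 𝒴 × F × F :=
    { toFun := fun z => (z.2.1, z.1, z.2.2)
      invFun := fun z => (z.2.1, z.1, z.2.2)
      left_inv := fun _ => rfl
      right_inv := fun _ => rfl }
  set P : 𝒴 × F × F → ℝ := law (prodLaw (unif F) R) e with hPdef
  have hP : P ∈ stdSimplex ℝ (𝒴 × F × F) := law_mem_stdSimplex hQ _
  have hlog : 0 < Real.log (Fintype.card F) :=
    Real.log_pos (by exact_mod_cast Fintype.one_lt_card)
  have hρsum : 0 < ∑ i, ρ i :=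
    Finset.sum_pos (fun i _ => hρ i) ⟨0, Finset.mem_univ _⟩
  have hR2 : law P (fun z => (z.1, z.2.2)) = R := by
    rw [hPdef, law_law]
    exact law_prodLaw_snd R hu
  have hfst : law P Prod.fst = law R Prod.fst := by
    have := law_law P (fun z => (z.1, z.2.2)) Prod.fst
    rw [hR2] at this
    exact this.symm
  have hunif : ∀ s t : F, s ≠ 0 → law P (fun z => (z.1, s * z.2.1 + t * z.2.2)) =
      prodLaw (law R Prod.fst) (unif F) := by
    intro s t hs
    rw [hPdef, law_law]
    exact law_add_unif R Prod.fst (fun z => t * z.2) hs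
  have hcond : condEntropy (prodLaw (law R Prod.fst) (unif F)) = Real.log (Fintype.card F) := by
    have hRX := law_mem_stdSimplex hR Prod.fst
    rw [condEntropy_eq (prodLaw_mem_stdSimplex hRX hu), entropy_prodLaw hRX hu,
      law_prodLaw_fst _ hu, entropy_unif]
    ring
  have hcomb : ∀ (s t : F) (i : Fin m), s ≠ 0 → combLaw s t (unif F) (U i) = unif F := by
    intro s t i hs
    have h1 := law_add_unif (U i) (fun _ => ()) (fun b => t * b) hs
    have h2 := congrArg (fun p => law p Prod.snd) h1
    simp only [law_law] at h2
    rw [law_prodLaw_snd _ (law_mem_stdSimplex (hU i) _)] at h2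
    exact h2
  have hcondP : condEntropy P = Real.log (Fintype.card F) + condEntropy R := by
    rw [condEntropy_eq hP, condEntropy_eq hR, hfst, hPdef, entropy_law_equiv,
      entropy_prodLaw hu hR, entropy_unif]
    ring
  have hsumlog : 0 < ∑ i, ρ i * Real.log (Fintype.card F) := by
    rw [← Finset.sum_mul]
    exact mul_pos hρsum hlog
  have hmain := eventually_exists_coverProb_ge_of_lt hP (fun _ => hu) hU hρ
    (by
      have := hunif 1 0 one_ne_zero
      simp only [one_mul, zero_mul, add_zero] at this
      rw [this, hcond, sub_self, entropy_unif]
      exact hsumlog)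
    (by rw [hR2]; exact h)
    (by
      simp only [hcondP, entropy_unif, mul_add, Finset.sum_add_distrib]
      linarith)
    (fun s t hs _ => by
      simp only [hunif s t hs, hcond, hcomb s t _ hs, entropy_unif, sub_self]
      exact hsumlog) hk hη
  filter_upwards [hmain] with n hn
  obtain ⟨G, b₁, b₂, hG⟩ := hn
  refine ⟨G, b₂, hG.trans ?_⟩
  unfold coverProb
  rw [hfst]
  refine Finset.sum_le_sum_of_subset_of_nonneg ?_
    fun x _ _ => wordProb_nonneg (law_mem_stdSimplex hR _).1 x
  intro x hx
  obtain ⟨v₁, -, v₂, hv₂, hv⟩ := (Finset.mem_filter.1 hx).2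
  refine Finset.mem_filter.2 ⟨Finset.mem_univ _, v₂, hv₂, ?_⟩
  have h1 := hv.comp fun z => (z.1, z.2.2)
  rwa [hR2] at h1

variable {P : 𝒳 × F × F → ℝ} {m : ℕ} {U₁ U₂ : Fin m → F → ℝ}

/-- If all `U_{1,i}` and `U_{2,i}` are deterministic, the targets are uniform and independent of the
source, and codes with a single word each suffice. -/
lemma eventually_exists_of_deterministic (hP : P ∈ stdSimplex ℝ (𝒳 × F × F))
    (hU₁ : ∀ i, U₁ i ∈ stdSimplex ℝ F) (hU₂ : ∀ i, U₂ i ∈ stdSimplex ℝ F)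
    (h₁ : ∀ i, entropy (U₁ i) = 0) (h₂ : ∀ i, entropy (U₂ i) = 0)
    (h₁₂ : 2 * Real.log (Fintype.card F) ≤ condEntropy P)
    (k : ℕ → Fin m → ℕ) {η : ℝ} (hη : 0 < η) :
    ∀ᶠ n : ℕ in atTop, ∃ (G : (i : Fin m) → Matrix (Fin (k n i)) (Fin n) F) (b₁ b₂ : Fin n → F),
      1 - η ≤ coverProb P η (qlc (k n) η U₁ G b₁) (qlc (k n) η U₂ G b₂) := by
  have hPu : P = prodLaw (law P Prod.fst) (unif (F × F)) := by
    refine (condEntropy_le_log_card hP).2 ?_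
    rw [Fintype.card_prod, Nat.cast_mul, Real.log_mul (by simp) (by simp)]
    linarith
  have hlim := tendsto_sum_wordProb_typical hP hη
  filter_upwards [hlim.eventually_const_lt (show 1 - η < 1 by linarith)] with n hn
  obtain ⟨w, hw⟩ := exists_sum_wordProb_ge (μ := law P Prod.fst)
    (unif_mem_stdSimplex (α := F × F)) (fun z : Fin n → 𝒳 × F × F => IsTypical η P z)
  rw [← hPu] at hw
  obtain ⟨b₁, hb₁⟩ := exists_mem_qlc (k := k n) hη.le hU₁ h₁ (fun _ => 0) (fun j => (w j).1)
  obtain ⟨b₂, hb₂⟩ := exists_mem_qlc (k := k n) hη.le hU₂ h₂ (fun _ => 0) (fun j => (w j).2)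
  refine ⟨fun _ => 0, b₁, b₂, (hn.le.trans hw).trans ?_⟩
  refine Finset.sum_le_sum_of_subset_of_nonneg ?_
    fun x _ _ => wordProb_nonneg (law_mem_stdSimplex hP _).1 x
  intro x hx
  exact Finset.mem_filter.2 ⟨Finset.mem_univ _, _, hb₁, _, hb₂, (Finset.mem_filter.1 hx).2⟩

/-- If all `U_{1,i}` are deterministic, `V₁` is uniform and independent of `X`. The first code is a
single word, which is treated as a part of the source that the second code has to cover. -/
lemma eventually_exists_of_deterministic_left (hP : P ∈ stdSimplex ℝ (𝒳 × F × F))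
    (hU₁ : ∀ i, U₁ i ∈ stdSimplex ℝ F) (hU₂ : ∀ i, U₂ i ∈ stdSimplex ℝ F)
    {ρ : Fin m → ℝ} (hρ : ∀ i, 0 < ρ i)
    (h₁ : ∀ i, entropy (U₁ i) = 0) (h₂ : ∃ i, 0 < entropy (U₂ i))
    (hV₁ : Real.log (Fintype.card F) ≤ condEntropy (law P fun z => (z.1, z.2.1)))
    (h₁₂ : 2 * Real.log (Fintype.card F) - condEntropy P < ∑ i, ρ i * entropy (U₂ i))
    {k : ℕ → Fin m → ℕ} (hk : ∀ i, Tendsto (fun n => (k n i : ℝ) / n) atTop (𝓝 (ρ i)))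
    {η : ℝ} (hη : 0 < η) :
    ∀ᶠ n : ℕ in atTop, ∃ (G : (i : Fin m) → Matrix (Fin (k n i)) (Fin n) F) (b₁ b₂ : Fin n → F),
      1 - η ≤ coverProb P η (qlc (k n) η U₁ G b₁) (qlc (k n) η U₂ G b₂) := by
  have hm : NeZero m := ⟨by
    obtain ⟨i, -⟩ := h₂
    exact (Fin.pos i).ne'⟩
  set P₁ : 𝒳 × F → ℝ := law P fun z => (z.1, z.2.1) with hP₁def
  have hP₁ : P₁ ∈ stdSimplex ℝ (𝒳 × F) := law_mem_stdSimplex hP _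
  let e : 𝒳 × F × F ≃ (𝒳 × F) × F := (Equiv.prodAssoc 𝒳 F F).symm
  set R : (𝒳 × F) × F → ℝ := law P e with hRdef
  have hR : R ∈ stdSimplex ℝ ((𝒳 × F) × F) := law_mem_stdSimplex hP _
  have hR1 : law R Prod.fst = P₁ := by
    rw [hRdef, law_law]
    rfl
  have hP₁X : law P₁ Prod.fst = law P Prod.fst := by
    rw [hP₁def, law_law]
    rfl
  have hRP : law R e.symm = P := by
    rw [hRdef, law_law, e.symm_comp_self, law_id]
  have hP₁u := (condEntropy_le_log_card hP₁).2 hV₁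
  have hlt : Real.log (Fintype.card F) - condEntropy R < ∑ i, ρ i * entropy (U₂ i) := by
    have h := (condEntropy_le_log_card hP₁).1
    rw [condEntropy_eq hP₁, hP₁X] at h
    rw [condEntropy_eq hP] at h₁₂
    rw [condEntropy_eq hR, hR1, hRdef, entropy_law_equiv]
    linarith
  filter_upwards [eventually_exists_single_cover hR hU₂ hρ hlt hk hη] with n hn
  obtain ⟨G, b₂, hG⟩ := hn
  rw [hR1, hP₁u, hP₁X] at hG
  obtain ⟨w, hw⟩ := exists_sum_wordProb_ge (μ := law P Prod.fst)
    (unif_mem_stdSimplex (α := F)) (fun y : Fin n → 𝒳 × F =>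
      ∃ v ∈ qlc (k n) η U₂ G b₂, IsTypical η R (fun j => (y j, v j)))
  obtain ⟨b₁, hb₁⟩ := exists_mem_qlc (k := k n) hη.le hU₁ h₁ G w
  refine ⟨G, b₁, b₂, (le_trans (hG.trans (le_of_eq ?_)) hw).trans ?_⟩
  · congr!
  refine Finset.sum_le_sum_of_subset_of_nonneg ?_
    fun x _ _ => wordProb_nonneg (law_mem_stdSimplex hP _).1 x
  intro x hx
  simp only [Finset.mem_filter, Finset.mem_univ, true_and] at hx
  obtain ⟨v, hv, ht⟩ := hx
  refine Finset.mem_filter.2 ⟨Finset.mem_univ _, w, hb₁, v, hv, ?_⟩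
  have h := ht.comp e.symm
  rwa [hRP] at h

omit [Field F] in
/-- The covering probability does not depend on the order of the two codes. -/
lemma coverProb_swap {n : ℕ} (hP : P ∈ stdSimplex ℝ (𝒳 × F × F)) (ε : ℝ)
    (C₁ C₂ : Set (Fin n → F)) :
    coverProb (law P (Equiv.prodCongr (Equiv.refl 𝒳) (Equiv.prodComm F F))) ε C₂ C₁ ≤
      coverProb P ε C₁ C₂ := by
  set e := Equiv.prodCongr (Equiv.refl 𝒳) (Equiv.prodComm F F)
  have hfst : law (law P e) Prod.fst = law P Prod.fst := law_law _ _ _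
  have hee : law (law P e) e = P := by
    rw [law_law]
    exact law_id P
  unfold coverProb
  rw [hfst]
  refine Finset.sum_le_sum_of_subset_of_nonneg ?_
    fun x _ _ => wordProb_nonneg (law_mem_stdSimplex hP _).1 x
  intro x hx
  obtain ⟨v₂, hv₂, v₁, hv₁, hv⟩ := (Finset.mem_filter.1 hx).2
  refine Finset.mem_filter.2 ⟨Finset.mem_univ _, v₁, hv₁, v₂, hv₂, ?_⟩
  have h := hv.comp e
  rwa [hee] at h

/-- Under the weak inequalities, codes exist for all dimensions that are asymptotically larger
than `ρ n`. -/
lemma eventually_exists_coverProb_ge_of_le (hP : P ∈ stdSimplex ℝ (𝒳 × F × F))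
    (hU₁ : ∀ i, U₁ i ∈ stdSimplex ℝ F) (hU₂ : ∀ i, U₂ i ∈ stdSimplex ℝ F)
    {ρ : Fin m → ℝ} (hρ : ∀ i, 0 < ρ i)
    (h₁ : Real.log (Fintype.card F) - condEntropy (law P fun z => (z.1, z.2.1)) ≤
      ∑ i, ρ i * entropy (U₁ i))
    (h₂ : Real.log (Fintype.card F) - condEntropy (law P fun z => (z.1, z.2.2)) ≤
      ∑ i, ρ i * entropy (U₂ i))
    (h₁₂ : 2 * Real.log (Fintype.card F) - condEntropy P ≤
      ∑ i, ρ i * (entropy (U₁ i) + entropy (U₂ i)))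
    (hst : ∀ s t : F, s ≠ 0 → t ≠ 0 → Real.log (Fintype.card F) -
        condEntropy (law P fun z => (z.1, s * z.2.1 + t * z.2.2)) ≤
      ∑ i, ρ i * entropy (combLaw s t (U₁ i) (U₂ i)))
    {ρ' : Fin m → ℝ} (hρ' : ∀ i, ρ i < ρ' i)
    {k : ℕ → Fin m → ℕ} (hk : ∀ i, Tendsto (fun n => (k n i : ℝ) / n) atTop (𝓝 (ρ' i)))
    {η : ℝ} (hη : 0 < η) :
    ∀ᶠ n : ℕ in atTop, ∃ (G : (i : Fin m) → Matrix (Fin (k n i)) (Fin n) F) (b₁ b₂ : Fin n → F),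
      1 - η ≤ coverProb P η (qlc (k n) η U₁ G b₁) (qlc (k n) η U₂ G b₂) := by
  have hρ'0 : ∀ i, 0 < ρ' i := fun i => (hρ i).trans (hρ' i)
  -- larger dimensions make every sum strictly larger, unless all its terms vanish
  have hlt : ∀ f : Fin m → ℝ, (∀ i, 0 ≤ f i) → (∃ i, 0 < f i) →
      ∑ i, ρ i * f i < ∑ i, ρ' i * f i := by
    rintro f hf ⟨i, hi⟩
    exact Finset.sum_lt_sum (fun j _ => mul_le_mul_of_nonneg_right (hρ' j).le (hf j))
      ⟨i, Finset.mem_univ i, mul_lt_mul_of_pos_right (hρ' i) hi⟩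
  have hn₁ : ∀ i, 0 ≤ entropy (U₁ i) := fun i => entropy_nonneg (hU₁ i)
  have hn₂ : ∀ i, 0 ≤ entropy (U₂ i) := fun i => entropy_nonneg (hU₂ i)
  by_cases hd₁ : ∃ i, 0 < entropy (U₁ i)
  · by_cases hd₂ : ∃ i, 0 < entropy (U₂ i)
    · refine eventually_exists_coverProb_ge_of_lt hP hU₁ hU₂ hρ'0 (h₁.trans_lt (hlt _ hn₁ hd₁))
        (h₂.trans_lt (hlt _ hn₂ hd₂)) (h₁₂.trans_lt (hlt _ (fun i => add_nonneg (hn₁ i) (hn₂ i))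
          (hd₁.imp fun i hi => add_pos_of_pos_of_nonneg hi (hn₂ i))))
        (fun s t hs ht => (hst s t hs ht).trans_lt (hlt _
          (fun i => entropy_nonneg (combLaw_mem_stdSimplex (hU₁ i) (hU₂ i) s t))
          (hd₁.imp fun i hi => entropy_combLaw_pos (hU₁ i) (hU₂ i) hs hi))) hk hη
    · push Not at hd₂
      have hz₂ : ∀ i, entropy (U₂ i) = 0 := fun i => le_antisymm (hd₂ i) (hn₂ i)
      simp only [hz₂, mul_zero, Finset.sum_const_zero, add_zero] at h₂ h₁₂
      set e := Equiv.prodCongr (Equiv.refl 𝒳) (Equiv.prodComm F F)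
      have hP' : law P e ∈ stdSimplex ℝ (𝒳 × F × F) := law_mem_stdSimplex hP _
      have hcond : condEntropy (law P e) = condEntropy P := by
        have hfst : law (law P e) Prod.fst = law P Prod.fst := law_law _ _ _
        rw [condEntropy_eq hP', condEntropy_eq hP, entropy_law_equiv, hfst]
      have hV : law (law P e) (fun z => (z.1, z.2.1)) = law P (fun z => (z.1, z.2.2)) :=
        law_law _ _ _
      have := eventually_exists_of_deterministic_left hP' hU₂ hU₁ hρ'0 hz₂ hd₁
        (by rw [hV]; linarith) (by rw [hcond]; exact h₁₂.trans_lt (hlt _ hn₁ hd₁)) hk hη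
      filter_upwards [this] with n hn
      obtain ⟨G, b₂, b₁, h⟩ := hn
      exact ⟨G, b₁, b₂, h.trans (coverProb_swap hP _ _ _)⟩
  · push Not at hd₁
    have hz₁ : ∀ i, entropy (U₁ i) = 0 := fun i => le_antisymm (hd₁ i) (hn₁ i)
    simp only [hz₁, mul_zero, Finset.sum_const_zero, zero_add] at h₁ h₁₂
    by_cases hd₂ : ∃ i, 0 < entropy (U₂ i)
    · exact eventually_exists_of_deterministic_left hP hU₁ hU₂ hρ'0 hz₁ hd₂ (by linarith)
        (h₁₂.trans_lt (hlt _ hn₂ hd₂)) hk hη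
    · push Not at hd₂
      have hz₂ : ∀ i, entropy (U₂ i) = 0 := fun i => le_antisymm (hd₂ i) (hn₂ i)
      simp only [hz₂, mul_zero, Finset.sum_const_zero] at h₁₂
      exact eventually_exists_of_deterministic hP hU₁ hU₂ hz₁ hz₂ (by linarith) k hη

end Degenerate

/-! ### Diagonal sequences of codes -/

section Diagonal

/-- If `p ℓ n` holds for all large `n`, for every `ℓ`, then `p (φ n) n` holds for all large `n`
for some `φ` that tends to infinity. -/
lemma exists_tendsto_atTop_eventually {p : ℕ → ℕ → Prop} (h : ∀ ℓ, ∀ᶠ n in atTop, p ℓ n) :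
    ∃ φ : ℕ → ℕ, Tendsto φ atTop atTop ∧ ∀ᶠ n in atTop, p (φ n) n := by
  classical
  refine ⟨fun n => Nat.findGreatest (fun ℓ => ∀ n' ≥ n, p ℓ n') n, ?_, ?_⟩
  · rw [tendsto_atTop]
    intro ℓ
    obtain ⟨N, hN⟩ := eventually_atTop.1 (h ℓ)
    filter_upwards [eventually_ge_atTop N, eventually_ge_atTop ℓ] with n hn hℓ
    exact Nat.le_findGreatest hℓ fun n' hn' => hN n' (hn.trans hn')
  · obtain ⟨N, hN⟩ := eventually_atTop.1 (h 0)
    filter_upwards [eventually_ge_atTop N] with n hn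
    exact Nat.findGreatest_spec (P := fun ℓ => ∀ n' ≥ n, p ℓ n') (Nat.zero_le n)
      (fun n' hn' => hN n' (hn.trans hn')) n le_rfl

variable {𝒳 F : Type*} [Fintype 𝒳] [Field F] [Fintype F] {P : 𝒳 × F × F → ℝ} {m : ℕ}
  {U₁ U₂ : Fin m → F → ℝ}

omit [Field F] in
lemma coverProb_le_one {n : ℕ} (hP : P ∈ stdSimplex ℝ (𝒳 × F × F)) (ε : ℝ)
    (C₁ C₂ : Set (Fin n → F)) : coverProb P ε C₁ C₂ ≤ 1 := by
  have hX := law_mem_stdSimplex hP Prod.fst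
  rw [← sum_wordProb (n := n) hX]
  exact Finset.sum_le_sum_of_subset_of_nonneg (Finset.subset_univ _)
    fun x _ _ => wordProb_nonneg hX.1 x

lemma exists_existsCoveringNQLC (hP : P ∈ stdSimplex ℝ (𝒳 × F × F)) (K : ℕ → ℕ → Fin m → ℕ)
    (h : ∀ ℓ : ℕ, ∀ᶠ n : ℕ in atTop,
      ∃ (G : (i : Fin m) → Matrix (Fin (K ℓ n i)) (Fin n) F) (b₁ b₂ : Fin n → F),
        1 - 1 / ((ℓ : ℝ) + 1) ≤ coverProb P (1 / ((ℓ : ℝ) + 1))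
          (qlc (K ℓ n) (1 / ((ℓ : ℝ) + 1)) U₁ G b₁) (qlc (K ℓ n) (1 / ((ℓ : ℝ) + 1)) U₂ G b₂)) :
    ∃ φ : ℕ → ℕ, Tendsto φ atTop atTop ∧ ExistsCoveringNQLC P U₁ U₂ fun n => K (φ n) n := by
  classical
  obtain ⟨φ, hφ, hev⟩ := exists_tendsto_atTop_eventually h
  have hε : Tendsto (fun n => 1 / ((φ n : ℝ) + 1)) atTop (𝓝 0) :=
    tendsto_one_div_add_atTop_nhds_zero_nat.comp hφ
  refine ⟨φ, hφ, fun n => 1 / ((φ n : ℝ) + 1), ?_⟩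
  -- the finitely many lengths without a good code get an arbitrary one
  have hch : ∀ n : ℕ, ∃ (G : (i : Fin m) → Matrix (Fin (K (φ n) n i)) (Fin n) F)
      (b₁ b₂ : Fin n → F),
      (∃ (G : (i : Fin m) → Matrix (Fin (K (φ n) n i)) (Fin n) F) (b₁ b₂ : Fin n → F),
        1 - 1 / ((φ n : ℝ) + 1) ≤ coverProb P (1 / ((φ n : ℝ) + 1))
          (qlc (K (φ n) n) (1 / ((φ n : ℝ) + 1)) U₁ G b₁)
          (qlc (K (φ n) n) (1 / ((φ n : ℝ) + 1)) U₂ G b₂)) →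
        1 - 1 / ((φ n : ℝ) + 1) ≤ coverProb P (1 / ((φ n : ℝ) + 1))
          (qlc (K (φ n) n) (1 / ((φ n : ℝ) + 1)) U₁ G b₁)
          (qlc (K (φ n) n) (1 / ((φ n : ℝ) + 1)) U₂ G b₂) := by
    intro n
    by_cases hn : ∃ (G : (i : Fin m) → Matrix (Fin (K (φ n) n i)) (Fin n) F) (b₁ b₂ : Fin n → F),
        1 - 1 / ((φ n : ℝ) + 1) ≤ coverProb P (1 / ((φ n : ℝ) + 1))
          (qlc (K (φ n) n) (1 / ((φ n : ℝ) + 1)) U₁ G b₁)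
          (qlc (K (φ n) n) (1 / ((φ n : ℝ) + 1)) U₂ G b₂)
    · obtain ⟨G, b₁, b₂, hG⟩ := hn
      exact ⟨G, b₁, b₂, fun _ => hG⟩
    · exact ⟨fun _ => 0, 0, 0, fun h => absurd h hn⟩
  choose G b₁ b₂ hG using hch
  refine ⟨fun n => qlc (K (φ n) n) (1 / ((φ n : ℝ) + 1)) U₁ (G n) (b₁ n),
    fun n => qlc (K (φ n) n) (1 / ((φ n : ℝ) + 1)) U₂ (G n) (b₂ n),
    fun n => by positivity, hε, fun n => ⟨G n, b₁ n, b₂ n, rfl, rfl⟩, fun ε hε0 => ?_⟩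
  have hlow : Tendsto (fun n => 1 - 1 / ((φ n : ℝ) + 1)) atTop (𝓝 1) := by
    simpa using hε.const_sub 1
  refine tendsto_of_tendsto_of_tendsto_of_le_of_le' hlow tendsto_const_nhds ?_
    (Eventually.of_forall fun n => coverProb_le_one hP _ _ _)
  filter_upwards [hev, hε.eventually_lt_const hε0] with n hn hlt
  exact (hG n hn).trans (coverProb_mono hP hlt.le le_rfl le_rfl)

lemma tendsto_natCeil_mul_div {c : ℕ → ℝ} {a : ℝ} (hc : ∀ n, 0 ≤ c n)
    (h : Tendsto c atTop (𝓝 a)) :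
    Tendsto (fun n : ℕ => (⌈(n : ℝ) * c n⌉₊ : ℝ) / n) atTop (𝓝 a) := by
  have hup : Tendsto (fun n : ℕ => c n + 1 / (n : ℝ)) atTop (𝓝 a) := by
    simpa using h.add tendsto_one_div_atTop_nhds_zero_nat
  refine tendsto_of_tendsto_of_tendsto_of_le_of_le' h hup ?_ ?_
  · filter_upwards [eventually_gt_atTop 0] with n hn
    rw [le_div_iff₀ (by exact_mod_cast hn), mul_comm]
    exact Nat.le_ceil _
  · filter_upwards [eventually_gt_atTop 0] with n hn
    have hn' : (0 : ℝ) < n := by exact_mod_cast hn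
    rw [div_le_iff₀ hn']
    refine (Nat.ceil_lt_add_one (mul_nonneg hn'.le (hc n))).le.trans (le_of_eq ?_)
    field_simp

end Diagonal

end NQLC

theorem mainTheorem2 {𝒳 F : Type*} [Fintype 𝒳] [Field F] [Fintype F]
    (P : 𝒳 × F × F → ℝ) (hP : P ∈ stdSimplex ℝ (𝒳 × F × F))
    (m : ℕ) (ρ : Fin m → ℝ) (hρ : ∀ i, 0 < ρ i)
    (U₁ U₂ : Fin m → F → ℝ)
    (hU₁ : ∀ i, U₁ i ∈ stdSimplex ℝ F) (hU₂ : ∀ i, U₂ i ∈ stdSimplex ℝ F) :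
    -- non-strict bounds: codes whose relative dimensions tend to `ρ`
    (∑ i, ρ i * entropy (U₁ i) ≥
        Real.log (Fintype.card F) - condEntropy (law P fun z => (z.1, z.2.1)) →
      ∑ i, ρ i * entropy (U₂ i) ≥
        Real.log (Fintype.card F) - condEntropy (law P fun z => (z.1, z.2.2)) →
      ∑ i, ρ i * (entropy (U₁ i) + entropy (U₂ i)) ≥
        2 * Real.log (Fintype.card F) - condEntropy P →
      (∀ s t : F, s ≠ 0 → t ≠ 0 →
        ∑ i, ρ i * entropy (combLaw s t (U₁ i) (U₂ i)) ≥
          Real.log (Fintype.card F) -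
            condEntropy (law P fun z => (z.1, s * z.2.1 + t * z.2.2))) →
      ∃ k : ℕ → Fin m → ℕ,
        (∀ i, Tendsto (fun n => (k n i : ℝ) / n) atTop (𝓝 (ρ i))) ∧
        ExistsCoveringNQLC P U₁ U₂ k) ∧
    -- strict bounds: every choice of dimensions whose ratios to `n` tend to `ρ`
    (∑ i, ρ i * entropy (U₁ i) >
        Real.log (Fintype.card F) - condEntropy (law P fun z => (z.1, z.2.1)) →
      ∑ i, ρ i * entropy (U₂ i) >
        Real.log (Fintype.card F) - condEntropy (law P fun z => (z.1, z.2.2)) →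
      ∑ i, ρ i * (entropy (U₁ i) + entropy (U₂ i)) >
        2 * Real.log (Fintype.card F) - condEntropy P →
      (∀ s t : F, s ≠ 0 → t ≠ 0 →
        ∑ i, ρ i * entropy (combLaw s t (U₁ i) (U₂ i)) >
          Real.log (Fintype.card F) -
            condEntropy (law P fun z => (z.1, s * z.2.1 + t * z.2.2))) →
      ∀ k : ℕ → Fin m → ℕ,
        (∀ i, Tendsto (fun n => (k n i : ℝ) / n) atTop (𝓝 (ρ i))) →
        ExistsCoveringNQLC P U₁ U₂ k) := by
  refine ⟨fun h₁ h₂ h₁₂ hst => ?_, fun h₁ h₂ h₁₂ hst k hk => ?_⟩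
  · obtain ⟨φ, hφ, hcov⟩ := exists_existsCoveringNQLC hP
      (fun ℓ n i => ⌈(n : ℝ) * (ρ i + 1 / ((ℓ : ℝ) + 1))⌉₊)
      (fun ℓ => eventually_exists_coverProb_ge_of_le hP hU₁ hU₂ hρ h₁ h₂ h₁₂ hst
        (ρ' := fun i => ρ i + 1 / ((ℓ : ℝ) + 1)) (fun i => lt_add_of_pos_right _ (by positivity))
        (fun i => tendsto_natCeil_mul_div (c := fun _ => ρ i + 1 / ((ℓ : ℝ) + 1))
          (fun _ => add_nonneg (hρ i).le (by positivity)) tendsto_const_nhds)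
        (by positivity))
    refine ⟨_, fun i => ?_, hcov⟩
    refine tendsto_natCeil_mul_div (c := fun n => ρ i + 1 / ((φ n : ℝ) + 1))
      (fun n => add_nonneg (hρ i).le (by positivity)) ?_
    simpa using (tendsto_one_div_add_atTop_nhds_zero_nat (𝕜 := ℝ).comp hφ).const_add (ρ i)
  · obtain ⟨φ, -, hcov⟩ := exists_existsCoveringNQLC hP (fun _ n => k n)
      (fun ℓ => eventually_exists_coverProb_ge_of_lt hP hU₁ hU₂ hρ h₁ h₂ h₁₂ hst hk
        (by positivity))
    exact hcov
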